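/- Let $A\subset\mathbb{R}[x]$ be a finite set of polynomials all of whose roots are real. For a measure $\mu$ on $\mathbb{R}$ let $I(\mu)=\iint\log|x-y|\,d\mu(x)\,d\mu(y)$ denote its logarithmic energy (with $\log 0=-\infty$). Let $\mu$ be a solution of the primal problem for $A$: a Borel probability measure supported on $[0,\infty)$ that minimizes $\int x\,d\mu(x)$ among all Borel probability measures supported on $[0,\infty)$ with $I(\mu)\ge 0$ and $\int\log|Q(x)|\,d\mu(x)\ge 0$ for every $Q\in A$. Then $\mu$ has a density with respect to Lebesgue measure, $d\mu(x)=f(x)\,dx$ on $(0,\infty)$ and $\mu(\{0\})=0$, where $f\ge 0$ is continuous on $(0,\infty)$. In particular, if $\Sigma$ denotes the support of $\mu$, then $f(a)=0$ for every boundary point $a>0$ of $\Sigma$. -/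

import Mathlib

open MeasureTheory Set Polynomial
open scoped ENNReal

/-- The function `log |x|` with its true value `-∞` at `x = 0`. -/
noncomputable def logAbs (x : ℝ) : EReal := ENNReal.log (ENNReal.ofReal |x|)

/-- The integral of an extended-real function: the integral of its positive part minus the
integral of its negative part. The undefined case `∞ - ∞` gets the value `-∞`. -/
noncomputable def extIntegral {α : Type*} [MeasurableSpace α] (μ : Measure α) (g : α → EReal) :
    EReal :=
  ((∫⁻ x, (g x).toENNReal ∂μ : ℝ≥0∞) : EReal) - ((∫⁻ x, (-(g x)).toENNReal ∂μ : ℝ≥0∞) : EReal)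

/-- The logarithmic energy `I(μ) = ∬ log |x - y| dμ(x) dμ(y)`. -/
noncomputable def logEnergy (μ : Measure ℝ) : EReal :=
  extIntegral (μ.prod μ) (fun p => logAbs (p.1 - p.2))

/-- The expectation `∫ x dμ(x)` of a measure supported on `[0, ∞)`, as an element of `[0, ∞]`. -/
noncomputable def expectation (μ : Measure ℝ) : ℝ≥0∞ := ∫⁻ x, ENNReal.ofReal x ∂μ

/-- The feasible measures of the primal problem for `A`: the probability measures supported on
`[0, ∞)` with `I(μ) ≥ 0` and `∫ log |Q| dμ ≥ 0` for every `Q ∈ A`. -/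
structure IsPrimalFeasible (A : Finset ℝ[X]) (μ : Measure ℝ) : Prop where
  isProbabilityMeasure : IsProbabilityMeasure μ
  nonneg_support : μ (Iio 0) = 0
  logEnergy_nonneg : 0 ≤ logEnergy μ
  log_nonneg : ∀ Q ∈ A, 0 ≤ extIntegral μ (fun x => logAbs (Q.eval x))

/-- The solutions of the primal problem for `A`: the feasible measures of least expectation. -/
structure IsPrimalSolution (A : Finset ℝ[X]) (μ : Measure ℝ) : Prop where
  feasible : IsPrimalFeasible A μ
  minimal : ∀ ν : Measure ℝ, IsPrimalFeasible A ν → expectation μ ≤ expectation ν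

lemma logAbs_of_ne_zero {x : ℝ} (hx : x ≠ 0) : logAbs x = (Real.log x : EReal) := by
  rw [logAbs, ENNReal.log_ofReal_of_pos (abs_pos.2 hx), Real.log_abs]

lemma logAbs_zero : logAbs 0 = ⊥ := by simp [logAbs]

lemma logAbs_nonneg {x : ℝ} (hx : 1 ≤ |x|) : 0 ≤ logAbs x := by
  have : x ≠ 0 := by rintro rfl; norm_num at hx
  rw [logAbs_of_ne_zero this, ← Real.log_abs]
  exact_mod_cast Real.log_nonneg hx

section ExtIntegral

variable {α : Type*} [MeasurableSpace α] {ν : Measure α}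

lemma extIntegral_eq_integral {g : α → EReal} {f : α → ℝ} (hf : Integrable f ν)
    (h : ∀ᵐ x ∂ν, g x = (f x : EReal)) : extIntegral ν g = ((∫ x, f x ∂ν : ℝ) : EReal) := by
  have h1 : ∫⁻ x, (g x).toENNReal ∂ν = ∫⁻ x, ENNReal.ofReal (f x) ∂ν := by
    refine lintegral_congr_ae ?_
    filter_upwards [h] with x hx
    rw [hx, EReal.real_coe_toENNReal]
  have h2 : ∫⁻ x, (-(g x)).toENNReal ∂ν = ∫⁻ x, ENNReal.ofReal (-f x) ∂ν := by
    refine lintegral_congr_ae ?_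
    filter_upwards [h] with x hx
    rw [hx, ← EReal.coe_neg, EReal.real_coe_toENNReal]
  have fin1 : ∫⁻ x, ENNReal.ofReal (f x) ∂ν ≠ ⊤ := hf.lintegral_lt_top.ne
  have fin2 : ∫⁻ x, ENNReal.ofReal (-f x) ∂ν ≠ ⊤ := hf.neg.lintegral_lt_top.ne
  rw [extIntegral, h1, h2, integral_eq_lintegral_pos_part_sub_lintegral_neg_part hf,
    EReal.coe_sub, EReal.coe_ennreal_toReal fin1, EReal.coe_ennreal_toReal fin2]

lemma extIntegral_nonneg {g : α → EReal} (h : ∀ᵐ x ∂ν, 0 ≤ g x) : 0 ≤ extIntegral ν g := by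
  have h2 : ∫⁻ x, (-(g x)).toENNReal ∂ν = 0 := by
    rw [← lintegral_zero (μ := ν)]
    refine lintegral_congr_ae ?_
    filter_upwards [h] with x hx
    exact EReal.toENNReal_of_nonpos (by simpa using hx)
  rw [extIntegral, h2]
  simpa using EReal.coe_ennreal_nonneg _

lemma lintegral_neg_ne_top_of_extIntegral_nonneg {g : α → EReal} (h : 0 ≤ extIntegral ν g) :
    ∫⁻ x, (-(g x)).toENNReal ∂ν ≠ ⊤ := by
  intro h2
  rw [extIntegral, h2] at h
  simp at h

lemma measurable_logAbs : Measurable logAbs :=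
  ENNReal.measurable_log.comp (ENNReal.measurable_ofReal.comp measurable_norm)

lemma ae_ne_zero_of_lintegral_neg_logAbs_ne_top {f : α → ℝ} (hf : Measurable f)
    (h : ∫⁻ x, (-(logAbs (f x))).toENNReal ∂ν ≠ ⊤) : ∀ᵐ x ∂ν, f x ≠ 0 := by
  have hm : Measurable fun x => (-(logAbs (f x))).toENNReal :=
    (measurable_logAbs.comp hf).neg.ereal_toENNReal
  filter_upwards [ae_lt_top hm h] with x hx h0
  rw [h0, logAbs_zero] at hx
  simp at hx

lemma integrable_log_of_lintegral_neg_logAbs_ne_top {f b : α → ℝ} (hf : Measurable f)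
    (hb : Integrable b ν) (hfb : ∀ᵐ x ∂ν, Real.log (f x) ≤ b x)
    (h : ∫⁻ x, (-(logAbs (f x))).toENNReal ∂ν ≠ ⊤) :
    Integrable (fun x => Real.log (f x)) ν := by
  have h0 := ae_ne_zero_of_lintegral_neg_logAbs_ne_top hf h
  refine ⟨(Real.measurable_log.comp hf).aestronglyMeasurable, ?_⟩
  rw [hasFiniteIntegral_iff_enorm]
  refine lt_of_le_of_lt (b := ∫⁻ x, (‖b x‖ₑ + (-(logAbs (f x))).toENNReal) ∂ν)
    (lintegral_mono_ae ?_) ?_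
  · filter_upwards [h0, hfb] with x hx hbx
    rw [logAbs_of_ne_zero hx, ← EReal.coe_neg, EReal.real_coe_toENNReal, Real.enorm_eq_ofReal_abs,
      Real.enorm_eq_ofReal_abs]
    rcases le_total 0 (Real.log (f x)) with h | h
    · refine le_add_right (ENNReal.ofReal_le_ofReal ?_)
      rw [abs_of_nonneg h]
      exact hbx.trans (le_abs_self _)
    · rw [abs_of_nonpos h]
      exact le_add_self
  · rw [lintegral_add_left' hb.aestronglyMeasurable.enorm]
    exact ENNReal.add_lt_top.2 ⟨hb.2, lt_top_iff_ne_top.2 h⟩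

end ExtIntegral

lemma measurable_fst_sub_snd : Measurable fun p : ℝ × ℝ => p.1 - p.2 :=
  measurable_fst.sub measurable_snd

lemma measurable_log_fst_sub_snd : Measurable fun p : ℝ × ℝ => Real.log (p.1 - p.2) :=
  Real.measurable_log.comp measurable_fst_sub_snd

lemma measurable_log_sub (r : ℝ) : Measurable fun x : ℝ => Real.log (x - r) :=
  Real.measurable_log.comp (measurable_id'.sub_const r)

lemma log_sub_le_abs_add_abs (x y : ℝ) : Real.log (x - y) ≤ |x| + |y| := by
  rw [← Real.log_abs]
  rcases eq_or_ne (x - y) 0 with h | h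
  · rw [h]; simp; positivity
  · have := Real.log_le_sub_one_of_pos (abs_pos.2 h)
    have := abs_sub x y
    linarith

/-- The probability measures on `[0, ∞)` with finite mean and finite logarithmic energy, and with
finite logarithmic potential at the points of `S`. -/
structure LogAdmissible (S : Finset ℝ) (ν : Measure ℝ) : Prop where
  prob : IsProbabilityMeasure ν
  nonneg : ν (Iio 0) = 0
  noAtoms : NullSingletonClass ν
  mean : Integrable (fun x => x) ν
  energy : Integrable (fun p : ℝ × ℝ => Real.log (p.1 - p.2)) (ν.prod ν)
  log_sub : ∀ r ∈ S, Integrable (fun x => Real.log (x - r)) ν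

lemma ae_nonneg_of_measure_Iio {ν : Measure ℝ} (h : ν (Iio 0) = 0) : ∀ᵐ x ∂ν, 0 ≤ x := by
  rw [ae_iff]
  simpa [Iio] using h

lemma noAtoms_of_ae_ne {ν : Measure ℝ} [SFinite ν] (h : ∀ᵐ p ∂(ν.prod ν), p.1 - p.2 ≠ 0) :
    NullSingletonClass ν := by
  refine ⟨fun x => ?_⟩
  have : (ν.prod ν) ({x} ×ˢ {x}) = 0 := by
    refine measure_mono_null ?_ (ae_iff.1 h)
    rintro ⟨a, b⟩ ⟨ha, hb⟩
    simp only [mem_singleton_iff] at ha hb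
    simp [ha, hb]
  rw [Measure.prod_prod] at this
  exact mul_self_eq_zero.1 this

lemma ae_prod_sub_ne_zero {ν : Measure ℝ} [SFinite ν] [NullSingletonClass ν] :
    ∀ᵐ p ∂(ν.prod ν), p.1 - p.2 ≠ 0 := by
  have hm : MeasurableSet {p : ℝ × ℝ | ¬ (p.1 - p.2 ≠ 0)} := by
    simp only [not_not]
    exact measurable_fst_sub_snd (measurableSet_singleton 0)
  rw [ae_iff, Measure.measure_prod_null hm]
  refine Filter.Eventually.of_forall fun x => ?_
  have : Prod.mk x ⁻¹' {p : ℝ × ℝ | ¬ (p.1 - p.2 ≠ 0)} ⊆ {x} := by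
    intro y hy
    simp only [not_not, mem_preimage, mem_ofPred_eq] at hy
    simp; linarith
  exact measure_mono_null this (measure_singleton x)

lemma ae_forall_ne {ν : Measure ℝ} [NullSingletonClass ν] (S : Finset ℝ) : ∀ᵐ x ∂ν, ∀ r ∈ S, x ≠ r := by
  rw [Finset.eventually_all]
  intro r _
  rw [ae_iff]
  simp

/-- All the roots of the polynomials in `A`. -/
noncomputable def allRoots (A : Finset ℝ[X]) : Finset ℝ := A.biUnion fun Q => Q.roots.toFinset

lemma ae_eval_ne_zero {ν : Measure ℝ} [NullSingletonClass ν] {Q : ℝ[X]} (hQ : Q ≠ 0) :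
    ∀ᵐ x ∂ν, Q.eval x ≠ 0 := by
  filter_upwards [ae_forall_ne (ν := ν) Q.roots.toFinset] with x hx h0
  exact hx x (by simp [hQ, h0]) rfl

lemma log_eval_eq {Q : ℝ[X]} (hs : Q.Splits) {x : ℝ} (hx : Q.eval x ≠ 0) :
    Real.log (Q.eval x) = Real.log Q.leadingCoeff
      + ∑ r ∈ Q.roots.toFinset, Q.rootMultiplicity r * Real.log (x - r) := by
  have h := congrArg (eval x) hs.eq_prod_roots
  rw [eval_mul, eval_C, eval_multiset_prod, Multiset.map_map, Finset.prod_multiset_map_count] at h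
  have h0 := hx
  rw [h, mul_ne_zero_iff, Finset.prod_ne_zero_iff] at h0
  rw [h, Real.log_mul h0.1 (Finset.prod_ne_zero_iff.2 h0.2), Real.log_prod h0.2]
  simp [Real.log_pow, count_roots]

lemma LogAdmissible.integrable_log_eval {S : Finset ℝ} {ν : Measure ℝ} (h : LogAdmissible S ν)
    {Q : ℝ[X]} (hs : Q.Splits) (hQ : Q ≠ 0) (hS : Q.roots.toFinset ⊆ S) :
    Integrable (fun x => Real.log (Q.eval x)) ν := by
  have := h.noAtoms
  have := h.prob
  have hi : Integrable (fun x => Real.log Q.leadingCoeff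
      + ∑ r ∈ Q.roots.toFinset, Q.rootMultiplicity r * Real.log (x - r)) ν :=
    (integrable_const _).add
      (integrable_finsetSum _ fun r hr => (h.log_sub r (hS hr)).const_mul _)
  refine hi.congr ?_
  filter_upwards [ae_eval_ne_zero (ν := ν) hQ] with x hx
  rw [log_eval_eq hs hx]

lemma LogAdmissible.integral_log_eval {S : Finset ℝ} {ν : Measure ℝ} (h : LogAdmissible S ν)
    {Q : ℝ[X]} (hs : Q.Splits) (hQ : Q ≠ 0) (hS : Q.roots.toFinset ⊆ S) :
    ∫ x, Real.log (Q.eval x) ∂ν = Real.log Q.leadingCoeff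
      + ∑ r ∈ Q.roots.toFinset, Q.rootMultiplicity r * ∫ x, Real.log (x - r) ∂ν := by
  have := h.noAtoms
  have := h.prob
  have hc : (fun x => Real.log (Q.eval x)) =ᵐ[ν] fun x => Real.log Q.leadingCoeff
      + ∑ r ∈ Q.roots.toFinset, Q.rootMultiplicity r * Real.log (x - r) := by
    filter_upwards [ae_eval_ne_zero (ν := ν) hQ] with x hx
    rw [log_eval_eq hs hx]
  have hi : ∀ r ∈ Q.roots.toFinset,
      Integrable (fun x => (Q.rootMultiplicity r : ℝ) * Real.log (x - r)) ν :=
    fun r hr => (h.log_sub r (hS hr)).const_mul _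
  rw [integral_congr_ae hc, integral_add (integrable_const _) (integrable_finsetSum _ hi),
    integral_finsetSum _ hi]
  simp [integral_const_mul]

lemma LogAdmissible.logEnergy_eq {S : Finset ℝ} {ν : Measure ℝ} (h : LogAdmissible S ν) :
    logEnergy ν = ((∫ p, Real.log (p.1 - p.2) ∂(ν.prod ν) : ℝ) : EReal) := by
  have := h.noAtoms
  have := h.prob
  refine extIntegral_eq_integral h.energy ?_
  filter_upwards [ae_prod_sub_ne_zero (ν := ν)] with p hp
  exact logAbs_of_ne_zero hp

lemma LogAdmissible.extIntegral_log_eval {S : Finset ℝ} {ν : Measure ℝ} (h : LogAdmissible S ν)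
    {Q : ℝ[X]} (hs : Q.Splits) (hQ : Q ≠ 0) (hS : Q.roots.toFinset ⊆ S) :
    extIntegral ν (fun x => logAbs (Q.eval x)) = ((∫ x, Real.log (Q.eval x) ∂ν : ℝ) : EReal) := by
  have := h.noAtoms
  refine extIntegral_eq_integral (h.integrable_log_eval hs hQ hS) ?_
  filter_upwards [ae_eval_ne_zero (ν := ν) hQ] with x hx
  exact logAbs_of_ne_zero hx

lemma IsPrimalFeasible.ne_zero {A : Finset ℝ[X]} {ν : Measure ℝ} (h : IsPrimalFeasible A ν)
    {Q : ℝ[X]} (hQ : Q ∈ A) : Q ≠ 0 := by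
  rintro rfl
  have := h.isProbabilityMeasure
  have := lintegral_neg_ne_top_of_extIntegral_nonneg (h.log_nonneg 0 hQ)
  simp [logAbs_zero] at this

lemma integrable_id_of_expectation {ν : Measure ℝ} (h0 : ν (Iio 0) = 0)
    (h : expectation ν ≠ ⊤) : Integrable (fun x => x) ν := by
  refine ⟨measurable_id'.aestronglyMeasurable, ?_⟩
  rw [hasFiniteIntegral_iff_ofReal (ae_nonneg_of_measure_Iio h0)]
  exact lt_top_iff_ne_top.2 h

lemma expectation_eq_ofReal {ν : Measure ℝ} (h0 : ν (Iio 0) = 0)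
    (h : Integrable (fun x => x) ν) : expectation ν = ENNReal.ofReal (∫ x, x ∂ν) :=
  (ofReal_integral_eq_lintegral_ofReal h (ae_nonneg_of_measure_Iio h0)).symm

lemma IsPrimalFeasible.logAdmissible {A : Finset ℝ[X]} {ν : Measure ℝ}
    (h : IsPrimalFeasible A ν) (hE : expectation ν ≠ ⊤) : LogAdmissible (allRoots A) ν := by
  have := h.isProbabilityMeasure
  have hE' := integrable_id_of_expectation h.nonneg_support hE
  have hneg := lintegral_neg_ne_top_of_extIntegral_nonneg h.logEnergy_nonneg
  have hna : NullSingletonClass ν := noAtoms_of_ae_ne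
    (ae_ne_zero_of_lintegral_neg_logAbs_ne_top measurable_fst_sub_snd hneg)
  have hsum : Integrable (fun p : ℝ × ℝ => |p.1| + |p.2|) (ν.prod ν) :=
    (hE'.abs.comp_fst ν).add (hE'.abs.comp_snd ν)
  refine ⟨this, h.nonneg_support, hna, hE',
    integrable_log_of_lintegral_neg_logAbs_ne_top measurable_fst_sub_snd
      hsum (Filter.Eventually.of_forall fun p => log_sub_le_abs_add_abs _ _) hneg, ?_⟩
  intro r hr
  simp only [allRoots, Finset.mem_biUnion, Multiset.mem_toFinset] at hr
  obtain ⟨Q, hQA, hr⟩ := hr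
  have hQ := h.ne_zero hQA
  obtain ⟨G, hG⟩ := dvd_iff_isRoot.2 (isRoot_of_mem_roots hr)
  have hnegQ := lintegral_neg_ne_top_of_extIntegral_nonneg (h.log_nonneg Q hQA)
  obtain ⟨M, hM⟩ := (isCompact_Icc (a := r - 1) (b := r + 1)).exists_bound_of_continuousOn
    G.continuous.continuousOn
  have hM0 : 0 ≤ M := (norm_nonneg _).trans (hM r ⟨by linarith, by linarith⟩)
  refine integrable_log_of_lintegral_neg_logAbs_ne_top (measurable_id'.sub_const r)
    (hE'.abs.add (integrable_const |r|))
    (Filter.Eventually.of_forall fun x => log_sub_le_abs_add_abs _ _) ?_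
  refine ne_top_of_le_ne_top (b := ∫⁻ x, ((-(logAbs (Q.eval x))).toENNReal
    + ENNReal.ofReal (Real.log (M + 1))) ∂ν) ?_ (lintegral_mono_ae ?_)
  · rw [lintegral_add_right _ measurable_const]
    simpa using hnegQ
  · filter_upwards [ae_eval_ne_zero (ν := ν) hQ] with x hx
    have hx' := hx
    rw [hG, eval_mul, mul_ne_zero_iff] at hx'
    have hxr : x - r ≠ 0 := by simpa using hx'.1
    rw [logAbs_of_ne_zero hx, logAbs_of_ne_zero hxr, ← EReal.coe_neg, ← EReal.coe_neg,
      EReal.real_coe_toENNReal, EReal.real_coe_toENNReal]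
    rcases le_total 1 |x - r| with h1 | h1
    · rw [ENNReal.ofReal_of_nonpos]
      · simp
      · rw [← Real.log_abs]
        simpa using Real.log_nonneg h1
    · rw [hG, eval_mul, eval_sub, eval_X, eval_C, Real.log_mul hxr hx'.2]
      have hGM : Real.log (G.eval x) ≤ Real.log (M + 1) := by
        rw [← Real.log_abs]
        refine Real.log_le_log (abs_pos.2 hx'.2) ?_
        have := hM x ⟨by linarith [(abs_le.1 h1).1], by linarith [(abs_le.1 h1).2]⟩
        rw [Real.norm_eq_abs] at this
        linarith
      refine le_trans (ENNReal.ofReal_le_ofReal ?_) ENNReal.ofReal_add_le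
      linarith

lemma LogAdmissible.isPrimalFeasible {A : Finset ℝ[X]} {ν : Measure ℝ}
    (h : LogAdmissible (allRoots A) ν) (hA : ∀ Q ∈ A, Q.Splits) (hA0 : ∀ Q ∈ A, Q ≠ 0)
    (hI : 0 ≤ ∫ p, Real.log (p.1 - p.2) ∂(ν.prod ν))
    (hQ : ∀ Q ∈ A, 0 ≤ ∫ x, Real.log (Q.eval x) ∂ν) : IsPrimalFeasible A ν where
  isProbabilityMeasure := h.prob
  nonneg_support := h.nonneg
  logEnergy_nonneg := by
    rw [h.logEnergy_eq]
    exact_mod_cast hI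
  log_nonneg Q hQA := by
    rw [h.extIntegral_log_eval (hA Q hQA) (hA0 Q hQA)
      (Finset.subset_biUnion_of_mem (fun Q : ℝ[X] => Q.roots.toFinset) hQA)]
    exact_mod_cast hQ Q hQA

lemma IsPrimalFeasible.one_le_abs_of_natDegree_eq_zero {A : Finset ℝ[X]} {ν : Measure ℝ}
    (h : IsPrimalFeasible A ν) {Q : ℝ[X]} (hQ : Q ∈ A) (hd : Q.natDegree = 0) (x : ℝ) :
    1 ≤ |Q.eval x| := by
  have := h.isProbabilityMeasure
  have h1 := h.log_nonneg Q hQ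
  have h0 := h.ne_zero hQ
  obtain ⟨c, rfl⟩ := natDegree_eq_zero.1 hd
  have hc : c ≠ 0 := by rintro rfl; simp at h0
  simp only [eval_C] at h1 ⊢
  rw [extIntegral_eq_integral (integrable_const (Real.log c))
    (Filter.Eventually.of_forall fun x => logAbs_of_ne_zero hc)] at h1
  simp only [integral_const, probReal_univ, smul_eq_mul, one_mul] at h1
  have h2 : 0 ≤ Real.log |c| := by rw [Real.log_abs]; exact_mod_cast h1
  by_contra! hlt
  exact absurd h2 (not_le.2 (Real.log_neg (abs_pos.2 hc) hlt))

lemma exists_forall_one_le_abs_eval (A : Finset ℝ[X])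
    (h : ∀ Q ∈ A, Q.natDegree = 0 → ∀ x, 1 ≤ |Q.eval x|) :
    ∃ c : ℝ, ∀ Q ∈ A, ∀ x, c ≤ x → 1 ≤ |Q.eval x| := by
  have : ∀ᶠ x in Filter.atTop, ∀ Q ∈ A, 1 ≤ |Q.eval x| := by
    rw [Finset.eventually_all]
    intro Q hQ
    rcases Nat.eq_zero_or_pos Q.natDegree with h0 | h0
    · exact Filter.Eventually.of_forall (h Q hQ h0)
    · exact (Q.abs_tendsto_atTop (natDegree_pos_iff_degree_pos.1 h0)).eventually_ge_atTop 1
  obtain ⟨c, hc⟩ := Filter.eventually_atTop.1 this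
  exact ⟨c, fun Q hQ x hx => hc x hx Q hQ⟩

lemma IsPrimalFeasible.exists_expectation_ne_top {A : Finset ℝ[X]} {μ : Measure ℝ}
    (h : IsPrimalFeasible A μ) : ∃ ν, IsPrimalFeasible A ν ∧ expectation ν ≠ ⊤ := by
  have := h.isProbabilityMeasure
  have hneg := lintegral_neg_ne_top_of_extIntegral_nonneg h.logEnergy_nonneg
  have hae := ae_ne_zero_of_lintegral_neg_logAbs_ne_top measurable_fst_sub_snd hneg
  obtain ⟨n, hn⟩ : ∃ n : ℕ, μ (Icc 0 (n : ℝ)) ≠ 0 := by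
    by_contra! hn
    have hU : (⋃ n : ℕ, Icc 0 (n : ℝ)) = Ici 0 := by
      ext x
      simp only [mem_iUnion, mem_Icc, mem_Ici]
      exact ⟨fun ⟨_, h, _⟩ => h, fun hx => ⟨⌈x⌉₊, hx, Nat.le_ceil x⟩⟩
    have h0 : μ (Ici 0) = 0 := by rw [← hU]; exact measure_iUnion_null hn
    have : μ univ = 0 := by
      rw [← Iio_union_Ici (a := (0 : ℝ))]
      exact measure_union_null h.nonneg_support h0
    simp at this
  set s := Icc 0 (n : ℝ) with hs
  set a := (μ s)⁻¹ with ha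
  have haT : a ≠ ⊤ := ENNReal.inv_ne_top.2 hn
  set ρ : Measure ℝ := a • μ.restrict s with hρ
  have hρp : IsProbabilityMeasure ρ := ⟨by
    rw [hρ, Measure.smul_apply, Measure.restrict_apply_univ, smul_eq_mul, ha,
      ENNReal.inv_mul_cancel hn (measure_ne_top _ _)]⟩
  have hρs : ∀ᵐ x ∂ρ, x ∈ s := by
    rw [hρ]
    exact Measure.ae_smul_measure (ae_restrict_mem measurableSet_Icc) a
  have hρρ : ρ.prod ρ = (a * a) • (μ.prod μ).restrict (s ×ˢ s) := by
    rw [hρ, Measure.prod_smul_left, Measure.prod_smul_right, smul_smul, Measure.prod_restrict]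
  have hneg' : ∫⁻ p, (-(logAbs (p.1 - p.2))).toENNReal ∂(ρ.prod ρ) ≠ ⊤ := by
    rw [hρρ, lintegral_smul_measure]
    exact ENNReal.mul_ne_top (ENNReal.mul_ne_top haT haT)
      (ne_top_of_le_ne_top hneg (setLIntegral_le_lintegral _ _))
  have hρae := ae_ne_zero_of_lintegral_neg_logAbs_ne_top measurable_fst_sub_snd hneg'
  have hid : Integrable (fun x => x) ρ := by
    refine Integrable.of_bound measurable_id'.aestronglyMeasurable (n : ℝ) ?_
    filter_upwards [hρs] with x hx
    rw [Real.norm_eq_abs, abs_of_nonneg hx.1]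
    exact hx.2
  have hlog := integrable_log_of_lintegral_neg_logAbs_ne_top measurable_fst_sub_snd
      ((hid.abs.comp_fst ρ).add (hid.abs.comp_snd ρ))
      (Filter.Eventually.of_forall fun p => log_sub_le_abs_add_abs _ _) hneg'
  obtain ⟨c₀, hc₀⟩ := exists_forall_one_le_abs_eval A
    fun Q hQ hd x => h.one_le_abs_of_natDegree_eq_zero hQ hd x
  set I := ∫ p, Real.log (p.1 - p.2) ∂(ρ.prod ρ) with hI
  set c := max c₀ (max 1 (Real.exp (-I))) with hc
  have hc1 : 1 ≤ c := (le_max_left _ _).trans (le_max_right _ _)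
  have hcI : -I ≤ Real.log c := by
    rw [Real.le_log_iff_exp_le (by linarith)]
    exact (le_max_right _ _).trans (le_max_right _ _)
  set φ : ℝ → ℝ := fun x => c * (x + 1) with hφ
  have hφm : Measurable φ := by fun_prop
  have hmap : ∀ᵐ y ∂(ρ.map φ), c ≤ y := by
    rw [ae_map_iff hφm.aemeasurable measurableSet_Ici]
    filter_upwards [hρs] with x hx
    have := hx.1
    simp only [hφ]
    nlinarith
  have hprob : IsProbabilityMeasure (ρ.map φ) := Measure.isProbabilityMeasure_map hφm.aemeasurable
  have hnn : (ρ.map φ) (Iio 0) = 0 := by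
    refine measure_mono_null ?_ (ae_iff.1 hmap)
    intro y hy
    simp only [mem_Iio] at hy
    simp only [mem_ofPred_eq]
    linarith
  refine ⟨ρ.map φ, ⟨hprob, hnn, ?_, ?_⟩, ?_⟩
  · have hm : Measurable (Prod.map φ φ) := hφm.prodMap hφm
    have e1 : extIntegral ((ρ.map φ).prod (ρ.map φ)) (fun p => logAbs (p.1 - p.2))
        = extIntegral (ρ.prod ρ) (fun p => logAbs (φ p.1 - φ p.2)) := by
      have hmm : Measurable fun p : ℝ × ℝ => logAbs (p.1 - p.2) :=
        measurable_logAbs.comp measurable_fst_sub_snd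
      have hnm : Measurable fun p : ℝ × ℝ => (-logAbs (p.1 - p.2)).toENNReal :=
        hmm.neg.ereal_toENNReal
      rw [Measure.map_prod_map _ _ hφm hφm, extIntegral, extIntegral,
        lintegral_map hmm.ereal_toENNReal hm, lintegral_map hnm hm]
      rfl
    rw [logEnergy, e1, extIntegral_eq_integral (f := fun p => Real.log c + Real.log (p.1 - p.2))
      ((integrable_const _).add hlog), integral_add (integrable_const _) hlog]
    · simp only [integral_const, probReal_univ, smul_eq_mul, one_mul]
      rw [← hI]
      exact_mod_cast (by linarith : 0 ≤ Real.log c + I)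
    · filter_upwards [hρae] with p hp
      rw [← Real.log_mul (by linarith) hp, ← logAbs_of_ne_zero (mul_ne_zero (by linarith) hp)]
      simp only [hφ]
      ring_nf
  · intro Q hQ
    refine extIntegral_nonneg ?_
    filter_upwards [hmap] with y hy
    exact logAbs_nonneg (hc₀ Q hQ y ((le_max_left _ _).trans hy))
  · have hi : Integrable (fun x => x) (ρ.map φ) := by
      rw [integrable_map_measure measurable_id'.aestronglyMeasurable hφm.aemeasurable]
      exact (hid.add (integrable_const 1)).const_mul c
    rw [expectation_eq_ofReal hnn hi]
    exact ENNReal.ofReal_ne_top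

lemma IsPrimalSolution.logAdmissible {A : Finset ℝ[X]} {μ : Measure ℝ}
    (h : IsPrimalSolution A μ) : LogAdmissible (allRoots A) μ := by
  obtain ⟨ν, hν, hE⟩ := h.feasible.exists_expectation_ne_top
  exact h.feasible.logAdmissible (ne_top_of_le_ne_top hE (h.minimal ν hν))

/-- The positive definite kernel `∫ s in 0..T, (s - d)⁺ / s ^ 2` at distance `d`; it agrees with
`- log d` up to a constant and a term that is small for large `T`. -/
noncomputable def tentKernel (T d : ℝ) : ℝ :=
  if d < T then Real.log T - Real.log d + d / T - 1 else 0

lemma tentKernel_sub_nonneg {T d : ℝ} (hT : 0 < T) (hd : 0 < d) :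
    Real.log T - 1 - Real.log d ≤ tentKernel T d := by
  rw [tentKernel]
  split_ifs with h
  · have : 0 ≤ d / T := by positivity
    linarith
  · have := Real.log_le_log hT (not_lt.1 h)
    linarith

lemma tentKernel_le {T d : ℝ} (hT : 0 < T) (hd : 0 < d) :
    tentKernel T d ≤ Real.log T - 1 - Real.log d + d / T := by
  rw [tentKernel]
  split_ifs with h
  · linarith
  · have := Real.log_le_sub_one_of_pos (div_pos hd hT)
    rw [Real.log_div hd.ne' hT.ne'] at this
    linarith

lemma tentKernel_nonneg {T d : ℝ} (hT : 0 < T) (hd : 0 < d) : 0 ≤ tentKernel T d := by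
  rw [tentKernel]
  split_ifs with h
  · have := Real.log_le_sub_one_of_pos (div_pos hd hT)
    rw [Real.log_div hd.ne' hT.ne'] at this
    linarith
  · exact le_rfl

lemma measurable_tentKernel (T : ℝ) : Measurable (tentKernel T) := by
  unfold tentKernel
  refine Measurable.ite measurableSet_Iio ?_ measurable_const
  fun_prop

lemma lintegral_tent_eq {T d : ℝ} (hd : 0 < d) :
    ∫⁻ s in Ioc 0 T, ENNReal.ofReal (1 / s ^ 2) * ENNReal.ofReal (s - d)
      = ENNReal.ofReal (tentKernel T d) := by
  rw [tentKernel]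
  split_ifs with h
  · have hU : Ioc 0 T = Ioc 0 d ∪ Ioc d T := (Ioc_union_Ioc_eq_Ioc hd.le h.le).symm
    have h0 : ∫⁻ s in Ioc 0 d, ENNReal.ofReal (1 / s ^ 2) * ENNReal.ofReal (s - d) = 0 := by
      rw [setLIntegral_congr_fun (g := fun _ => 0) measurableSet_Ioc]
      · simp
      · intro s hs
        simp only
        rw [ENNReal.ofReal_of_nonpos (by linarith [hs.2] : s - d ≤ 0), mul_zero]
    rw [hU, lintegral_union measurableSet_Ioc (Ioc_disjoint_Ioc_of_le le_rfl), h0, zero_add]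
    have hpos : ∀ x ∈ uIcc d T, 0 < x := fun x hx => by
      rw [uIcc_of_le h.le] at hx; linarith [hx.1]
    have hcont : ContinuousOn (fun s : ℝ => 1 / s ^ 2 * (s - d)) (uIcc d T) := by
      refine ContinuousOn.mul (continuousOn_const.div (by fun_prop) fun x hx => ?_) (by fun_prop)
      exact pow_ne_zero 2 (hpos x hx).ne'
    have hint : IntervalIntegrable (fun s : ℝ => 1 / s ^ 2 * (s - d)) volume d T :=
      hcont.intervalIntegrable
    have hI : ∫ s in d..T, 1 / s ^ 2 * (s - d) = (Real.log T + d / T) - (Real.log d + d / d) := by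
      refine intervalIntegral.integral_eq_sub_of_hasDerivAt
        (f := fun s => Real.log s + d / s) (fun x hx => ?_) hint
      have hx := (hpos x hx).ne'
      have h1 := (Real.hasDerivAt_log hx).add ((hasDerivAt_inv hx).const_mul d)
      refine (h1.congr_deriv ?_)
      field_simp
      ring
    rw [div_self hd.ne'] at hI
    have : Real.log T - Real.log d + d / T - 1 = ∫ s in Ioc d T, 1 / s ^ 2 * (s - d) := by
      rw [← intervalIntegral.integral_of_le h.le, hI]; ring
    rw [this, ofReal_integral_eq_lintegral_ofReal]
    · refine setLIntegral_congr_fun measurableSet_Ioc fun s hs => ?_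
      rw [ENNReal.ofReal_mul (by positivity)]
    · exact (intervalIntegrable_iff_integrableOn_Ioc_of_le h.le).1 hint
    · refine (ae_restrict_iff' measurableSet_Ioc).2 (Filter.Eventually.of_forall fun s hs => ?_)
      have : 0 ≤ s - d := by linarith [hs.1]
      simp only [Pi.zero_apply]
      positivity
  · rw [ENNReal.ofReal_zero, setLIntegral_congr_fun (g := fun _ => 0) measurableSet_Ioc]
    · simp
    · intro s hs
      simp only
      rw [ENNReal.ofReal_of_nonpos (by linarith [hs.2] : s - d ≤ 0), mul_zero]

lemma lintegral_ofReal_sub_abs (ν : Measure ℝ) [SFinite ν] (s : ℝ) :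
    ∫⁻ p, ENNReal.ofReal (s - |p.1 - p.2|) ∂(ν.prod ν) = ∫⁻ u, ν (Icc u (u + s)) ^ 2 := by
  set B : Set ((ℝ × ℝ) × ℝ) :=
    ({q | q.2 ≤ q.1.1} ∩ {q | q.1.1 ≤ q.2 + s}) ∩ ({q | q.2 ≤ q.1.2} ∩ {q | q.1.2 ≤ q.2 + s})
    with hB
  have hBm : MeasurableSet B :=
    ((measurableSet_le (by fun_prop) (by fun_prop)).inter
      (measurableSet_le (by fun_prop) (by fun_prop))).inter
    ((measurableSet_le (by fun_prop) (by fun_prop)).inter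
      (measurableSet_le (by fun_prop) (by fun_prop)))
  have hswap := lintegral_lintegral_swap (μ := ν.prod ν) (ν := (volume : Measure ℝ))
    (f := fun p u => B.indicator (fun _ => (1 : ℝ≥0∞)) (p, u))
    ((measurable_const.indicator hBm).aemeasurable)
  have h1 : ∀ p : ℝ × ℝ, ∫⁻ u, B.indicator (fun _ => (1 : ℝ≥0∞)) (p, u)
      = ENNReal.ofReal (s - |p.1 - p.2|) := by
    intro p
    have : (fun u => B.indicator (fun _ => (1 : ℝ≥0∞)) (p, u))
        = (Icc (max p.1 p.2 - s) (min p.1 p.2)).indicator (fun _ => 1) := by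
      ext u
      refine indicator_eq_indicator ?_ rfl
      simp only [hB, mem_inter_iff, mem_ofPred_eq, mem_Icc, le_min_iff, sub_le_iff_le_add, max_le_iff]
      tauto
    rw [this, lintegral_indicator measurableSet_Icc, setLIntegral_const, one_mul, Real.volume_Icc]
    congr 1
    rw [← max_sub_min_eq_abs, max_comm p.2, min_comm p.2]
    ring
  have h2 : ∀ u : ℝ, ∫⁻ p, B.indicator (fun _ => (1 : ℝ≥0∞)) (p, u) ∂(ν.prod ν)
      = ν (Icc u (u + s)) ^ 2 := by
    intro u
    have : (fun p => B.indicator (fun _ => (1 : ℝ≥0∞)) (p, u))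
        = (Icc u (u + s) ×ˢ Icc u (u + s)).indicator (fun _ => 1) := by
      ext p
      refine indicator_eq_indicator ?_ rfl
      simp only [hB, mem_inter_iff, mem_ofPred_eq, mem_prod, mem_Icc]
    rw [this, lintegral_indicator (measurableSet_Icc.prod measurableSet_Icc), setLIntegral_const,
      one_mul, Measure.prod_prod, sq]
  simpa only [h1, h2] using hswap

lemma lintegral_tentKernel (ν : Measure ℝ) [SFinite ν] [NullSingletonClass ν] (T : ℝ) :
    ∫⁻ p, ENNReal.ofReal (tentKernel T |p.1 - p.2|) ∂(ν.prod ν)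
      = ∫⁻ s in Ioc 0 T, ENNReal.ofReal (1 / s ^ 2) * ∫⁻ u, ν (Icc u (u + s)) ^ 2 := by
  have h1 : ∫⁻ p, ENNReal.ofReal (tentKernel T |p.1 - p.2|) ∂(ν.prod ν)
      = ∫⁻ p, (∫⁻ s in Ioc 0 T, ENNReal.ofReal (1 / s ^ 2) * ENNReal.ofReal (s - |p.1 - p.2|))
        ∂(ν.prod ν) := by
    refine lintegral_congr_ae ?_
    filter_upwards [ae_prod_sub_ne_zero (ν := ν)] with p hp
    rw [lintegral_tent_eq (abs_pos.2 hp)]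
  rw [h1, lintegral_lintegral_swap]
  · refine lintegral_congr fun s => ?_
    rw [lintegral_const_mul _ (by fun_prop), lintegral_ofReal_sub_abs]
  · refine Measurable.aemeasurable ?_
    have : Measurable fun q : (ℝ × ℝ) × ℝ =>
      ENNReal.ofReal (1 / q.2 ^ 2) * ENNReal.ofReal (q.2 - |q.1.1 - q.1.2|) := by fun_prop
    exact this

lemma lintegral_tentKernel_mix_le (μ ν : Measure ℝ) [IsFiniteMeasure μ] [IsFiniteMeasure ν]
    [NullSingletonClass μ] [NullSingletonClass ν] {a b : ℝ≥0∞} (hab : a + b = 1)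
    [IsFiniteMeasure (a • μ + b • ν)] [NullSingletonClass (a • μ + b • ν)] (T : ℝ) :
    ∫⁻ p, ENNReal.ofReal (tentKernel T |p.1 - p.2|) ∂((a • μ + b • ν).prod (a • μ + b • ν))
      ≤ a * ∫⁻ p, ENNReal.ofReal (tentKernel T |p.1 - p.2|) ∂(μ.prod μ)
        + b * ∫⁻ p, ENNReal.ofReal (tentKernel T |p.1 - p.2|) ∂(ν.prod ν) := by
  have hm : ∀ (ρ : Measure ℝ) [IsFiniteMeasure ρ],
      Measurable fun q : ℝ × ℝ => ρ (Icc q.2 (q.2 + q.1)) := by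
    intro ρ _
    have hB : MeasurableSet ({q : (ℝ × ℝ) × ℝ | q.1.2 ≤ q.2} ∩ {q | q.2 ≤ q.1.2 + q.1.1}) :=
      (measurableSet_le (by fun_prop) (by fun_prop)).inter
        (measurableSet_le (by fun_prop) (by fun_prop))
    exact measurable_measure_prodMk_left hB
  have hm1 : ∀ (ρ : Measure ℝ) [IsFiniteMeasure ρ] (s : ℝ),
      Measurable fun u : ℝ => ρ (Icc u (u + s)) ^ 2 := by
    intro ρ _ s
    exact ((hm ρ).comp (measurable_const.prodMk measurable_id : Measurable fun u => (s, u))).pow_const 2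
  have hm2 : ∀ (ρ : Measure ℝ) [IsFiniteMeasure ρ], Measurable fun s : ℝ =>
      ENNReal.ofReal (1 / s ^ 2) * ∫⁻ u, ρ (Icc u (u + s)) ^ 2 := by
    intro ρ _
    refine Measurable.mul (by fun_prop) ?_
    exact Measurable.lintegral_prod_right ((hm ρ).pow_const 2)
  have hconv : ∀ x y : ℝ≥0∞, (a * x + b * y) ^ 2 ≤ a * x ^ 2 + b * y ^ 2 := by
    intro x y
    have := ENNReal.rpow_arith_mean_le_arith_mean2_rpow a b x y hab one_le_two
    simpa only [ENNReal.rpow_two] using this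
  rw [lintegral_tentKernel _ T, lintegral_tentKernel _ T, lintegral_tentKernel _ T,
    ← lintegral_const_mul _ (hm2 μ), ← lintegral_const_mul _ (hm2 ν),
    ← lintegral_add_left ((hm2 μ).const_mul a)]
  refine lintegral_mono fun s => ?_
  calc ENNReal.ofReal (1 / s ^ 2) * ∫⁻ u, (a • μ + b • ν) (Icc u (u + s)) ^ 2
      ≤ ENNReal.ofReal (1 / s ^ 2)
        * ∫⁻ u, (a * μ (Icc u (u + s)) ^ 2 + b * ν (Icc u (u + s)) ^ 2) := by
        gcongr with u
        simpa using hconv _ _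
    _ = _ := by
        rw [lintegral_add_left ((hm1 μ s).const_mul a), lintegral_const_mul _ (hm1 μ s),
          lintegral_const_mul _ (hm1 ν s)]
        ring

namespace LogAdmissible

variable {S : Finset ℝ} {μ ν : Measure ℝ}

lemma integrable_abs_sub (h : LogAdmissible S ν) :
    Integrable (fun p : ℝ × ℝ => |p.1 - p.2|) (ν.prod ν) := by
  have := h.prob
  exact ((h.mean.comp_fst ν).sub (h.mean.comp_snd ν)).abs

lemma integrable_tentKernel (h : LogAdmissible S ν) {T : ℝ} (hT : 0 < T) :
    Integrable (fun p : ℝ × ℝ => tentKernel T |p.1 - p.2|) (ν.prod ν) := by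
  have := h.prob
  have := h.noAtoms
  refine ((((integrable_const (|Real.log T - 1|)).add h.energy.abs).add
    (h.integrable_abs_sub.div_const T))).mono'
    ((measurable_tentKernel T).comp measurable_fst_sub_snd.abs).aestronglyMeasurable ?_
  filter_upwards [ae_prod_sub_ne_zero (ν := ν)] with p hp
  rw [Real.norm_eq_abs, abs_of_nonneg (tentKernel_nonneg hT (abs_pos.2 hp))]
  refine (tentKernel_le hT (abs_pos.2 hp)).trans ?_
  rw [Real.log_abs]
  have h1 := le_abs_self (Real.log T - 1)
  have h2 := neg_abs_le (Real.log (p.1 - p.2))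
  simp only [Pi.add_apply]
  linarith

lemma lintegral_tentKernel_eq (h : LogAdmissible S ν) {T : ℝ} (hT : 0 < T) :
    ∫⁻ p, ENNReal.ofReal (tentKernel T |p.1 - p.2|) ∂(ν.prod ν)
      = ENNReal.ofReal (∫ p, tentKernel T |p.1 - p.2| ∂(ν.prod ν)) := by
  have := h.prob
  have := h.noAtoms
  rw [ofReal_integral_eq_lintegral_ofReal (h.integrable_tentKernel hT)]
  filter_upwards [ae_prod_sub_ne_zero (ν := ν)] with p hp
  exact tentKernel_nonneg hT (abs_pos.2 hp)

lemma integral_tentKernel_nonneg (h : LogAdmissible S ν) {T : ℝ} (hT : 0 < T) :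
    0 ≤ ∫ p, tentKernel T |p.1 - p.2| ∂(ν.prod ν) := by
  have := h.prob
  have := h.noAtoms
  refine integral_nonneg_of_ae ?_
  filter_upwards [ae_prod_sub_ne_zero (ν := ν)] with p hp
  exact tentKernel_nonneg hT (abs_pos.2 hp)

lemma le_integral_tentKernel (h : LogAdmissible S ν) {T : ℝ} (hT : 0 < T) :
    Real.log T - 1 - ∫ p, Real.log (p.1 - p.2) ∂(ν.prod ν)
      ≤ ∫ p, tentKernel T |p.1 - p.2| ∂(ν.prod ν) := by
  have := h.prob
  have := h.noAtoms
  have e : Real.log T - 1 - ∫ p, Real.log (p.1 - p.2) ∂(ν.prod ν)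
      = ∫ p, (Real.log T - 1 - Real.log (p.1 - p.2)) ∂(ν.prod ν) := by
    rw [integral_sub (integrable_const _) h.energy]
    simp
  rw [e]
  refine integral_mono_ae ((integrable_const _).sub h.energy) (h.integrable_tentKernel hT) ?_
  filter_upwards [ae_prod_sub_ne_zero (ν := ν)] with p hp
  have := tentKernel_sub_nonneg hT (abs_pos.2 hp)
  rwa [Real.log_abs] at this

lemma integral_tentKernel_le (h : LogAdmissible S ν) {T : ℝ} (hT : 0 < T) :
    ∫ p, tentKernel T |p.1 - p.2| ∂(ν.prod ν)
      ≤ Real.log T - 1 - ∫ p, Real.log (p.1 - p.2) ∂(ν.prod ν)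
        + (∫ p, |p.1 - p.2| ∂(ν.prod ν)) / T := by
  have := h.prob
  have := h.noAtoms
  have hi : Integrable (fun p : ℝ × ℝ => Real.log T - 1 - Real.log (p.1 - p.2)) (ν.prod ν) :=
    (integrable_const _).sub h.energy
  have e : Real.log T - 1 - ∫ p, Real.log (p.1 - p.2) ∂(ν.prod ν)
        + (∫ p, |p.1 - p.2| ∂(ν.prod ν)) / T
      = ∫ p, (Real.log T - 1 - Real.log (p.1 - p.2) + |p.1 - p.2| / T) ∂(ν.prod ν) := by
    rw [integral_add hi (h.integrable_abs_sub.div_const T),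
      integral_sub (integrable_const _) h.energy, integral_div]
    simp
  rw [e]
  refine integral_mono_ae (h.integrable_tentKernel hT)
    (hi.add (h.integrable_abs_sub.div_const T)) ?_
  filter_upwards [ae_prod_sub_ne_zero (ν := ν)] with p hp
  have := tentKernel_le hT (abs_pos.2 hp)
  rwa [Real.log_abs] at this

section Mix

variable {a b : ℝ}

lemma isProbabilityMeasure_mix [IsProbabilityMeasure μ] [IsProbabilityMeasure ν]
    (ha : 0 ≤ a) (hb : 0 ≤ b) (hab : a + b = 1) :
    IsProbabilityMeasure (ENNReal.ofReal a • μ + ENNReal.ofReal b • ν) :=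
  ⟨by simp [← ENNReal.ofReal_add ha hb, hab]⟩

lemma nullSingletonClass_mix [NullSingletonClass μ] [NullSingletonClass ν] :
    NullSingletonClass (ENNReal.ofReal a • μ + ENNReal.ofReal b • ν) :=
  ⟨fun x => by simp⟩

lemma integral_mix {f : ℝ → ℝ} (hf : Integrable f μ) (hg : Integrable f ν) (ha : 0 ≤ a)
    (hb : 0 ≤ b) : ∫ x, f x ∂(ENNReal.ofReal a • μ + ENNReal.ofReal b • ν)
      = a * ∫ x, f x ∂μ + b * ∫ x, f x ∂ν := by
  rw [integral_add_measure (hf.smul_measure ENNReal.ofReal_ne_top)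
    (hg.smul_measure ENNReal.ofReal_ne_top), integral_smul_measure, integral_smul_measure,
    ENNReal.toReal_ofReal ha, ENNReal.toReal_ofReal hb, smul_eq_mul, smul_eq_mul]

lemma mix (hμ : LogAdmissible S μ) (hν : LogAdmissible S ν) (ha : 0 ≤ a) (hb : 0 ≤ b)
    (hab : a + b = 1) : LogAdmissible S (ENNReal.ofReal a • μ + ENNReal.ofReal b • ν) := by
  have := hμ.prob
  have := hν.prob
  have := hμ.noAtoms
  have := hν.noAtoms
  have hp := isProbabilityMeasure_mix (μ := μ) (ν := ν) ha hb hab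
  have hn := nullSingletonClass_mix (μ := μ) (ν := ν) (a := a) (b := b)
  have hadd : ∀ f : ℝ → ℝ, Integrable f μ → Integrable f ν →
      Integrable f (ENNReal.ofReal a • μ + ENNReal.ofReal b • ν) := fun f h1 h2 =>
    (h1.smul_measure ENNReal.ofReal_ne_top).add_measure (h2.smul_measure ENNReal.ofReal_ne_top)
  have hmean := hadd _ hμ.mean hν.mean
  refine ⟨hp, by simp [hμ.nonneg, hν.nonneg], hn, hmean, ?_,
    fun r hr => hadd _ (hμ.log_sub r hr) (hν.log_sub r hr)⟩
  set ρ := ENNReal.ofReal a • μ + ENNReal.ofReal b • ν with hρ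
  have hab' : ENNReal.ofReal a + ENNReal.ofReal b = 1 := by
    rw [← ENNReal.ofReal_add ha hb, hab, ENNReal.ofReal_one]
  have hle := lintegral_tentKernel_mix_le μ ν hab' 1
  rw [← hρ, hμ.lintegral_tentKernel_eq one_pos, hν.lintegral_tentKernel_eq one_pos] at hle
  have htent : Integrable (fun p : ℝ × ℝ => tentKernel 1 |p.1 - p.2|) (ρ.prod ρ) := by
    refine ⟨((measurable_tentKernel 1).comp measurable_fst_sub_snd.abs).aestronglyMeasurable, ?_⟩
    rw [hasFiniteIntegral_iff_ofReal]
    · exact hle.trans_lt (ENNReal.add_lt_top.2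
        ⟨ENNReal.mul_lt_top ENNReal.ofReal_lt_top ENNReal.ofReal_lt_top,
        ENNReal.mul_lt_top ENNReal.ofReal_lt_top ENNReal.ofReal_lt_top⟩)
    · filter_upwards [ae_prod_sub_ne_zero (ν := ρ)] with p hp
      exact tentKernel_nonneg one_pos (abs_pos.2 hp)
  refine ((htent.add (integrable_const 1)).add
    ((hmean.comp_fst ρ).sub (hmean.comp_snd ρ)).abs).mono'
    measurable_log_fst_sub_snd.aestronglyMeasurable ?_
  filter_upwards [ae_prod_sub_ne_zero (ν := ρ)] with p hp
  have h1 := tentKernel_sub_nonneg one_pos (abs_pos.2 hp)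
  have h2 := tentKernel_nonneg one_pos (abs_pos.2 hp)
  have h3 := Real.log_le_sub_one_of_pos (abs_pos.2 hp)
  rw [Real.log_abs] at h1 h3
  rw [Real.log_one] at h1
  simp only [Pi.add_apply, Pi.sub_apply, Real.norm_eq_abs, abs_le]
  constructor <;> linarith [abs_nonneg (p.1 - p.2)]

lemma le_energy_mix (hμ : LogAdmissible S μ) (hν : LogAdmissible S ν) (ha : 0 ≤ a) (hb : 0 ≤ b)
    (hab : a + b = 1) :
    a * ∫ p, Real.log (p.1 - p.2) ∂(μ.prod μ) + b * ∫ p, Real.log (p.1 - p.2) ∂(ν.prod ν)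
      ≤ ∫ p, Real.log (p.1 - p.2) ∂((ENNReal.ofReal a • μ + ENNReal.ofReal b • ν).prod
        (ENNReal.ofReal a • μ + ENNReal.ofReal b • ν)) := by
  have hρ := hμ.mix hν ha hb hab
  have := hμ.prob
  have := hν.prob
  have := hμ.noAtoms
  have := hν.noAtoms
  have := hρ.prob
  have := hρ.noAtoms
  have hab' : ENNReal.ofReal a + ENNReal.ofReal b = 1 := by
    rw [← ENNReal.ofReal_add ha hb, hab, ENNReal.ofReal_one]
  set M := a * (∫ p, |p.1 - p.2| ∂(μ.prod μ)) + b * ∫ p, |p.1 - p.2| ∂(ν.prod ν) with hM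
  have hM0 : 0 ≤ M := by
    have h1 : 0 ≤ ∫ p, |p.1 - p.2| ∂(μ.prod μ) := integral_nonneg fun _ => abs_nonneg _
    have h2 : 0 ≤ ∫ p, |p.1 - p.2| ∂(ν.prod ν) := integral_nonneg fun _ => abs_nonneg _
    positivity
  refine le_of_forall_pos_le_add fun ε hε => ?_
  obtain ⟨T, hT, hMT⟩ : ∃ T : ℝ, 0 < T ∧ M / T ≤ ε := by
    refine ⟨M / ε + 1, by positivity, ?_⟩
    rw [div_le_iff₀ (by positivity)]
    have : ε * (M / ε + 1) = M + ε := by field_simp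
    linarith
  have hle := lintegral_tentKernel_mix_le μ ν hab' T
  rw [hμ.lintegral_tentKernel_eq hT, hν.lintegral_tentKernel_eq hT,
    hρ.lintegral_tentKernel_eq hT, ← ENNReal.ofReal_mul ha, ← ENNReal.ofReal_mul hb,
    ← ENNReal.ofReal_add (mul_nonneg ha (hμ.integral_tentKernel_nonneg hT))
      (mul_nonneg hb (hν.integral_tentKernel_nonneg hT)),
    ENNReal.ofReal_le_ofReal_iff (add_nonneg (mul_nonneg ha (hμ.integral_tentKernel_nonneg hT))
      (mul_nonneg hb (hν.integral_tentKernel_nonneg hT)))] at hle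
  have h1 := hρ.le_integral_tentKernel hT
  have h2 := mul_le_mul_of_nonneg_left (hμ.integral_tentKernel_le hT) ha
  have h3 := mul_le_mul_of_nonneg_left (hν.integral_tentKernel_le hT) hb
  have e : M / T = a * ((∫ p, |p.1 - p.2| ∂(μ.prod μ)) / T)
      + b * ((∫ p, |p.1 - p.2| ∂(ν.prod ν)) / T) := by rw [hM]; ring
  have e2 : (a + b) * (Real.log T - 1) = Real.log T - 1 := by rw [hab, one_mul]
  linarith

end Mix

end LogAdmissible

lemma exists_nonneg_multipliers {ι : Type*} [Fintype ι] {t : Set (ι → ℝ)}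
    (ht : Convex ℝ t) (hne : t.Nonempty) (h : ∀ v ∈ t, ∃ i, v i ≤ 0) :
    ∃ l : ι → ℝ, (∀ i, 0 ≤ l i) ∧ (∃ i, 0 < l i) ∧ ∀ v ∈ t, ∑ i, l i * v i ≤ 0 := by
  classical
  have hopen : IsOpen (univ.pi fun _ : ι => Ioi (0 : ℝ)) :=
    isOpen_set_pi finite_univ fun _ _ => isOpen_Ioi
  have hconv : Convex ℝ (univ.pi fun _ : ι => Ioi (0 : ℝ)) :=
    convex_pi fun _ _ => convex_Ioi 0
  have hdisj : Disjoint (univ.pi fun _ : ι => Ioi (0 : ℝ)) t := by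
    rw [Set.disjoint_left]
    intro v hv hvt
    obtain ⟨i, hi⟩ := h v hvt
    exact absurd (hv i (mem_univ i)) (not_lt.2 hi)
  obtain ⟨f, u, hs, hu⟩ := geometric_hahn_banach_open hconv hopen ht hdisj
  have hmem : ∀ v : ι → ℝ, (∀ i, 0 < v i) → f v < u := fun v hv => hs v fun i _ => hv i
  have hcone : ∀ v : ι → ℝ, (∀ i, 0 < v i) → f v ≤ 0 := by
    intro v hv
    by_contra! hlt
    have h1 := hmem ((|u| / f v + 1) • v) fun i => by
      have := hv i
      simp only [Pi.smul_apply, smul_eq_mul]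
      positivity
    rw [map_smul, smul_eq_mul, add_mul, div_mul_cancel₀ _ hlt.ne'] at h1
    linarith [le_abs_self u]
  have hu0 : 0 ≤ u := by
    by_contra! hlt
    set v : ι → ℝ := fun _ => 1 with hv
    have h1 : ∀ c : ℝ, 0 < c → c * f v < u := fun c hc => by
      have := hmem (c • v) fun i => by simpa [hv] using hc
      simpa using this
    have h2 : 0 < |f v| + 1 := by positivity
    have h3 := h1 (-u / (2 * (|f v| + 1))) (by have := neg_pos.2 hlt; positivity)
    have h4 : -u / (2 * (|f v| + 1)) * f v = -(-u / (2 * (|f v| + 1)) * -f v) := by ring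
    have h5 : -u / (2 * (|f v| + 1)) * -f v ≤ -u / (2 * (|f v| + 1)) * (|f v| + 1) := by
      have := neg_pos.2 hlt
      gcongr
      linarith [neg_le_abs (f v)]
    have h6 : -u / (2 * (|f v| + 1)) * (|f v| + 1) = -u / 2 := by field_simp
    linarith
  have hrep : ∀ v, f v = ∑ i, v i * f (Pi.single i 1) := fun v => by
    conv_lhs => rw [pi_eq_sum_univ' v]
    simp [map_sum]
  have hl : ∀ i, f (Pi.single i 1) ≤ 0 := by
    intro i
    refine le_of_forall_pos_le_add fun ε hε => ?_
    set w : ι → ℝ := fun _ => 1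
    have h1 := hcone (Pi.single i 1 + (ε / (|f w| + 1)) • w) fun j => by
      have : 0 ≤ (Pi.single i 1 : ι → ℝ) j := by
        by_cases hj : j = i
        · subst hj; simp
        · simp [hj]
      simp only [Pi.add_apply, Pi.smul_apply, smul_eq_mul, w]
      positivity
    rw [map_add, map_smul, smul_eq_mul] at h1
    have h2 : ε / (|f w| + 1) * -f w ≤ ε / (|f w| + 1) * (|f w| + 1) := by
      gcongr
      linarith [neg_le_abs (f w)]
    have h3 : ε / (|f w| + 1) * (|f w| + 1) = ε := by field_simp
    linarith
  refine ⟨fun i => -f (Pi.single i 1), fun i => neg_nonneg.2 (hl i), ?_, ?_⟩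
  · by_contra! hz
    have hz' : ∀ i, f (Pi.single i 1) = 0 := fun i =>
      le_antisymm (hl i) (by simpa using hz i)
    have hf : ∀ v, f v = 0 := fun v => by rw [hrep]; simp [hz']
    obtain ⟨v, hv⟩ := hne
    have h1 := hu v hv
    have h2 := hmem (fun _ => 1) fun _ => one_pos
    rw [hf] at h1 h2
    linarith
  · intro v hv
    have := hu v hv
    rw [hrep] at this
    have e : ∑ i, -f (Pi.single i 1) * v i = -∑ i, v i * f (Pi.single i 1) := by
      rw [← Finset.sum_neg_distrib]
      exact Finset.sum_congr rfl fun i _ => by ring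
    rw [e]
    linarith

/-- The Lagrangian of the primal problem: expectation minus potentials minus energy. -/
noncomputable def lagrangian (a l : ℝ) (S : Finset ℝ) (m : ℝ → ℝ) (ν : Measure ℝ) : ℝ :=
  a * ∫ x, x ∂ν - ∑ r ∈ S, m r * ∫ x, Real.log (x - r) ∂ν
    - l * ∫ p, Real.log (p.1 - p.2) ∂(ν.prod ν)

/-- The set of constraint values that are dominated by an admissible measure. -/
def dominatedValues (A A' : Finset ℝ[X]) (e : ℝ) : Set (Option (Option A') → ℝ) :=
  {v | ∃ ν, LogAdmissible (allRoots A) ν ∧ v none ≤ e - ∫ x, x ∂ν ∧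
    v (some none) ≤ ∫ p, Real.log (p.1 - p.2) ∂(ν.prod ν) ∧
    ∀ Q : A', v (some (some Q)) ≤ ∫ x, Real.log ((Q : ℝ[X]).eval x) ∂ν}

lemma convex_dominatedValues {A A' : Finset ℝ[X]} (hAA : A' ⊆ A) (hA : ∀ Q ∈ A, Q.Splits)
    (hA0 : ∀ Q ∈ A, Q ≠ 0) (e : ℝ) : Convex ℝ (dominatedValues A A' e) := by
  rintro v ⟨μ, hμ, hμE, hμI, hμQ⟩ w ⟨ν, hν, hνE, hνI, hνQ⟩ a b ha hb hab
  refine ⟨_, hμ.mix hν ha hb hab, ?_, ?_, fun Q => ?_⟩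
  · rw [LogAdmissible.integral_mix hμ.mean hν.mean ha hb]
    simp only [Pi.add_apply, Pi.smul_apply, smul_eq_mul]
    have h1 := mul_le_mul_of_nonneg_left hμE ha
    have h2 := mul_le_mul_of_nonneg_left hνE hb
    have : (a + b) * e = e := by rw [hab, one_mul]
    linarith
  · refine le_trans ?_ (hμ.le_energy_mix hν ha hb hab)
    exact add_le_add (mul_le_mul_of_nonneg_left hμI ha) (mul_le_mul_of_nonneg_left hνI hb)
  · have hQ := hAA Q.2
    have hR : (Q : ℝ[X]).roots.toFinset ⊆ allRoots A :=
      Finset.subset_biUnion_of_mem (fun Q : ℝ[X] => Q.roots.toFinset) hQ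
    rw [LogAdmissible.integral_mix (hμ.integrable_log_eval (hA _ hQ) (hA0 _ hQ) hR)
      (hν.integrable_log_eval (hA _ hQ) (hA0 _ hQ) hR) ha hb]
    exact add_le_add (mul_le_mul_of_nonneg_left (hμQ Q) ha)
      (mul_le_mul_of_nonneg_left (hνQ Q) hb)

lemma IsPrimalSolution.exists_lagrangian_le {A : Finset ℝ[X]} (hA : ∀ Q ∈ A, Q.Splits)
    {μ : Measure ℝ} (h : IsPrimalSolution A μ) :
    ∃ (a l : ℝ) (S : Finset ℝ) (m : ℝ → ℝ), 0 ≤ a ∧ 0 ≤ l ∧ S ⊆ allRoots A ∧ (∀ r ∈ S, 0 < m r) ∧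
      (0 < a ∨ 0 < l ∨ S.Nonempty) ∧
      ∀ ν, LogAdmissible (allRoots A) ν → lagrangian a l S m μ ≤ lagrangian a l S m ν := by
  classical
  set A' := A.filter fun Q => Q.natDegree ≠ 0 with hA'
  have hAA : A' ⊆ A := Finset.filter_subset _ _
  have hA0 : ∀ Q ∈ A, Q ≠ 0 := fun Q hQ => h.feasible.ne_zero hQ
  have hμ := h.logAdmissible
  set e := ∫ x, x ∂μ with he
  have hsub : ∀ Q ∈ A, Q.roots.toFinset ⊆ allRoots A := fun Q hQ =>
    Finset.subset_biUnion_of_mem (fun Q : ℝ[X] => Q.roots.toFinset) hQ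
  have hIμ : 0 ≤ ∫ p, Real.log (p.1 - p.2) ∂(μ.prod μ) := by
    have := h.feasible.logEnergy_nonneg
    rw [hμ.logEnergy_eq] at this
    exact_mod_cast this
  have hQμ : ∀ Q ∈ A, 0 ≤ ∫ x, Real.log (Q.eval x) ∂μ := fun Q hQ => by
    have := h.feasible.log_nonneg Q hQ
    rw [hμ.extIntegral_log_eval (hA Q hQ) (hA0 Q hQ) (hsub Q hQ)] at this
    exact_mod_cast this
  obtain ⟨c, hc0, ⟨i, hi⟩, hc⟩ := exists_nonneg_multipliers
    (convex_dominatedValues hAA hA hA0 e)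
    ⟨fun i => i.elim 0 fun j => j.elim (∫ p, Real.log (p.1 - p.2) ∂(μ.prod μ))
      fun Q => ∫ x, Real.log ((Q : ℝ[X]).eval x) ∂μ, μ, hμ, by simp [he], le_rfl, fun Q => le_rfl⟩
    (by
      rintro v ⟨ν, hν, hE, hI, hQ⟩
      by_contra! hv
      have hf : IsPrimalFeasible A ν := by
        refine hν.isPrimalFeasible hA hA0 ((hv _).le.trans hI) fun Q hQA => ?_
        by_cases hd : Q.natDegree = 0
        · refine integral_nonneg fun x => ?_
          rw [Pi.zero_apply, ← Real.log_abs]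
          exact Real.log_nonneg (h.feasible.one_le_abs_of_natDegree_eq_zero hQA hd x)
        · have hQA' : Q ∈ A' := Finset.mem_filter.2 ⟨hQA, hd⟩
          exact (hv _).le.trans (hQ ⟨Q, hQA'⟩)
      have h1 := h.minimal ν hf
      rw [expectation_eq_ofReal hμ.nonneg hμ.mean, expectation_eq_ofReal hν.nonneg hν.mean,
        ENNReal.ofReal_le_ofReal_iff (integral_nonneg_of_ae (ae_nonneg_of_measure_Iio hν.nonneg))]
        at h1
      linarith [hv none])
  have hval : ∀ ν, LogAdmissible (allRoots A) ν →
      c none * (e - ∫ x, x ∂ν) + (c (some none) * ∫ p, Real.log (p.1 - p.2) ∂(ν.prod ν)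
        + ∑ Q : A', c (some (some Q)) * ∫ x, Real.log ((Q : ℝ[X]).eval x) ∂ν) ≤ 0 := by
    intro ν hν
    have := hc (fun i => i.elim (e - ∫ x, x ∂ν) fun j =>
      j.elim (∫ p, Real.log (p.1 - p.2) ∂(ν.prod ν))
      fun Q => ∫ x, Real.log ((Q : ℝ[X]).eval x) ∂ν) ⟨ν, hν, le_rfl, le_rfl, fun Q => le_rfl⟩
    simpa [Fintype.sum_option] using this
  set m : ℝ → ℝ := fun r => ∑ Q : A', c (some (some Q)) * (Q : ℝ[X]).rootMultiplicity r with hm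
  have hm0 : ∀ r, 0 ≤ m r := fun r =>
    Finset.sum_nonneg fun Q _ => mul_nonneg (hc0 _) (Nat.cast_nonneg _)
  set S := (allRoots A).filter fun r => 0 < m r with hS
  have hsum : ∀ ν, LogAdmissible (allRoots A) ν →
      ∑ Q : A', c (some (some Q)) * ∫ x, Real.log ((Q : ℝ[X]).eval x) ∂ν
      = (∑ Q : A', c (some (some Q)) * Real.log (Q : ℝ[X]).leadingCoeff)
        + ∑ r ∈ S, m r * ∫ x, Real.log (x - r) ∂ν := by
    intro ν hν
    have e1 : ∑ r ∈ S, m r * ∫ x, Real.log (x - r) ∂ν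
        = ∑ r ∈ allRoots A, m r * ∫ x, Real.log (x - r) ∂ν := by
      refine Finset.sum_subset (Finset.filter_subset _ _) fun r hr hrS => ?_
      have : m r = 0 := by
        refine le_antisymm ?_ (hm0 r)
        by_contra! hlt
        exact hrS (Finset.mem_filter.2 ⟨hr, hlt⟩)
      rw [this, zero_mul]
    rw [e1]
    simp only [hm, Finset.sum_mul]
    rw [Finset.sum_comm, ← Finset.sum_add_distrib]
    refine Finset.sum_congr rfl fun Q _ => ?_
    have hQ := hAA Q.2
    rw [hν.integral_log_eval (hA _ hQ) (hA0 _ hQ) (hsub _ hQ), mul_add, Finset.mul_sum]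
    congr 1
    rw [Finset.sum_subset (hsub _ hQ)]
    · exact Finset.sum_congr rfl fun r _ => by ring
    · intro r _ hr
      have : (Q : ℝ[X]).rootMultiplicity r = 0 := by
        rw [← count_roots]
        exact Multiset.count_eq_zero_of_notMem (by simpa using hr)
      rw [this]
      simp
  refine ⟨c none, c (some none), S, m, hc0 _, hc0 _, Finset.filter_subset _ _,
    fun r hr => (Finset.mem_filter.1 hr).2, ?_, ?_⟩
  · rcases i with _ | _ | Q
    · exact Or.inl hi
    · exact Or.inr (Or.inl hi)
    · refine Or.inr (Or.inr ?_)
      have hQ := Finset.mem_filter.1 Q.2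
      obtain ⟨r, hr⟩ := Multiset.card_pos_iff_exists_mem.1
        ((hA _ hQ.1).natDegree_eq_card_roots ▸ Nat.pos_of_ne_zero hQ.2)
      refine ⟨r, Finset.mem_filter.2 ⟨hsub _ hQ.1 (by simpa using hr), ?_⟩⟩
      refine lt_of_lt_of_le ?_ (Finset.single_le_sum
        (f := fun Q : A' => c (some (some Q)) * ((Q : ℝ[X]).rootMultiplicity r : ℝ))
        (fun Q _ => mul_nonneg (hc0 _) (Nat.cast_nonneg _)) (Finset.mem_univ Q))
      have : 0 < (Q : ℝ[X]).rootMultiplicity r := by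
        rw [← count_roots]; exact Multiset.count_pos.2 hr
      positivity
  · intro ν hν
    have h1 := hval ν hν
    have h2 : 0 ≤ ∑ Q : A', c (some (some Q)) * ∫ x, Real.log ((Q : ℝ[X]).eval x) ∂μ :=
      Finset.sum_nonneg fun Q _ => mul_nonneg (hc0 _) (hQμ _ (hAA Q.2))
    have h3 := mul_nonneg (hc0 (some none)) hIμ
    rw [hsum ν hν] at h1
    rw [hsum μ hμ] at h2
    simp only [lagrangian]
    rw [← he]
    linarith

section Removal

open Filter Topology

lemma integral_restrict_smul {α : Type*} [MeasurableSpace α] {ν : Measure α} {s : Set α}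
    (c : ℝ≥0∞) (f : α → ℝ) :
    ∫ x, f x ∂(c • ν.restrict s) = c.toReal * ∫ x in s, f x ∂ν := by
  rw [integral_smul_measure, smul_eq_mul]

lemma tendsto_setIntegral_of_ae_iUnion {α : Type*} [MeasurableSpace α] {ν : Measure α}
    {B : ℕ → Set α} (hB : ∀ n, MeasurableSet (B n)) (hmono : Monotone B)
    (hU : ∀ᵐ x ∂ν, x ∈ ⋃ n, B n) {f : α → ℝ} (hf : Integrable f ν) :
    Tendsto (fun n => ∫ x in B n, f x ∂ν) atTop (𝓝 (∫ x, f x ∂ν)) := by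
  have := tendsto_setIntegral_of_monotone hB hmono (f := f) (μ := ν) hf.integrableOn
  rwa [Measure.restrict_eq_self_of_ae_mem hU] at this

/-- Minimality extends to measures whose potential is infinite at a point of `R \ S`. -/
lemma lagrangian_le_of_subset {a l : ℝ} {S R : Finset ℝ} {m : ℝ → ℝ} {c : ℝ}
    (hmin : ∀ ν, LogAdmissible R ν → c ≤ lagrangian a l S m ν)
    {ν : Measure ℝ} (hν : LogAdmissible S ν) : c ≤ lagrangian a l S m ν := by
  have := hν.prob
  have := hν.noAtoms
  set B : ℕ → Set ℝ := fun n => ⋂ r ∈ R, {x | 1 / ((n : ℝ) + 1) ≤ |x - r|} with hB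
  have hBm : ∀ n, MeasurableSet (B n) := fun n =>
    Finset.measurableSet_biInter _ fun r _ => measurableSet_le (by fun_prop) (by fun_prop)
  have hBmem : ∀ n x, x ∈ B n ↔ ∀ r ∈ R, 1 / ((n : ℝ) + 1) ≤ |x - r| := by
    intro n x; simp [hB]
  have hmono : Monotone B := by
    intro n k hnk x hx
    rw [hBmem] at hx ⊢
    exact fun r hr => (Nat.one_div_le_one_div hnk).trans (hx r hr)
  have hU : ∀ᵐ x ∂ν, x ∈ ⋃ n, B n := by
    filter_upwards [ae_forall_ne (ν := ν) R] with x hx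
    have : ∀ᶠ n : ℕ in atTop, ∀ r ∈ R, 1 / ((n : ℝ) + 1) ≤ |x - r| := by
      rw [Finset.eventually_all]
      intro r hr
      exact (tendsto_one_div_add_atTop_nhds_zero_nat (𝕜 := ℝ)).eventually_le_const
        (abs_pos.2 (sub_ne_zero.2 (hx r hr)))
    obtain ⟨n, hn⟩ := this.exists
    exact mem_iUnion.2 ⟨n, (hBmem n x).2 hn⟩
  have hU2 : ∀ᵐ p ∂(ν.prod ν), p ∈ ⋃ n, B n ×ˢ B n := by
    have h1 : ∀ᵐ p ∂(ν.prod ν), p.1 ∈ ⋃ n, B n := Measure.quasiMeasurePreserving_fst.ae hU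
    have h2 : ∀ᵐ p ∂(ν.prod ν), p.2 ∈ ⋃ n, B n := Measure.quasiMeasurePreserving_snd.ae hU
    filter_upwards [h1, h2] with p hp1 hp2
    obtain ⟨i, hi⟩ := mem_iUnion.1 hp1
    obtain ⟨j, hj⟩ := mem_iUnion.1 hp2
    exact mem_iUnion.2 ⟨max i j, hmono (le_max_left _ _) hi, hmono (le_max_right _ _) hj⟩
  set w : ℕ → ℝ≥0∞ := fun n => (ν (B n))⁻¹ with hw
  have hν1 : Tendsto (fun n => ν.real (B n)) atTop (𝓝 1) := by
    have := tendsto_setIntegral_of_ae_iUnion hBm hmono hU (integrable_const (1 : ℝ))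
    simpa using this
  have hwT : Tendsto (fun n => (w n).toReal) atTop (𝓝 1) := by
    have := hν1.inv₀ one_ne_zero
    simpa [hw, Measure.real, ENNReal.toReal_inv] using this
  have hlim : Tendsto (fun n => lagrangian a l S m (w n • ν.restrict (B n))) atTop
      (𝓝 (lagrangian a l S m ν)) := by
    have hprod : ∀ n, (w n • ν.restrict (B n)).prod (w n • ν.restrict (B n))
        = (w n * w n) • (ν.prod ν).restrict (B n ×ˢ B n) := fun n => by
      rw [Measure.prod_smul_left, Measure.prod_smul_right, smul_smul, Measure.prod_restrict]
    simp only [lagrangian, hprod, integral_restrict_smul, ENNReal.toReal_mul]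
    have e : lagrangian a l S m ν = a * (1 * ∫ x, x ∂ν)
        - ∑ r ∈ S, m r * (1 * ∫ x, Real.log (x - r) ∂ν)
        - l * (1 * 1 * ∫ p, Real.log (p.1 - p.2) ∂(ν.prod ν)) := by simp [lagrangian]
    simp only [lagrangian] at e
    rw [e]
    refine (((hwT.mul (tendsto_setIntegral_of_ae_iUnion hBm hmono hU hν.mean)).const_mul a).sub
      (tendsto_finsetSum _ fun r hr =>
        (hwT.mul (tendsto_setIntegral_of_ae_iUnion hBm hmono hU (hν.log_sub r hr))).const_mul
          (m r))).sub (((hwT.mul hwT).mul ?_).const_mul l)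
    exact tendsto_setIntegral_of_ae_iUnion (fun n => (hBm n).prod (hBm n))
      (fun n k hnk => prod_mono (hmono hnk) (hmono hnk)) hU2 hν.energy
  refine ge_of_tendsto hlim ?_
  filter_upwards [hν1.eventually_const_lt one_pos] with n hn
  have hn0 : ν (B n) ≠ 0 := fun h0 => by simp [Measure.real, h0] at hn
  have hwn : w n ≠ ⊤ := ENNReal.inv_ne_top.2 hn0
  have hi : ∀ f : ℝ → ℝ, Integrable f ν → Integrable f (w n • ν.restrict (B n)) :=
    fun f hf => hf.restrict.smul_measure hwn
  have hp : IsProbabilityMeasure (w n • ν.restrict (B n)) := ⟨by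
    rw [Measure.smul_apply, Measure.restrict_apply_univ, smul_eq_mul, hw,
      ENNReal.inv_mul_cancel hn0 (measure_ne_top _ _)]⟩
  refine hmin _ ⟨hp, ?_, ⟨fun x => ?_⟩, hi _ hν.mean, ?_, fun r hr => ?_⟩
  · rw [Measure.smul_apply, Measure.restrict_apply measurableSet_Iio,
      measure_mono_null inter_subset_left hν.nonneg, smul_zero]
  · simp
  · rw [Measure.prod_smul_left, Measure.prod_smul_right, smul_smul, Measure.prod_restrict]
    exact hν.energy.restrict.smul_measure (ENNReal.mul_ne_top hwn hwn)
  · refine Integrable.smul_measure ?_ hwn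
    have hb : Integrable (fun x : ℝ => |x| + |r| + Real.log ((n : ℝ) + 1)) (ν.restrict (B n)) :=
      ((hν.mean.abs.add (integrable_const _)).add (integrable_const _)).restrict
    refine hb.mono'
      (measurable_log_sub r).aestronglyMeasurable ?_
    filter_upwards [ae_restrict_mem (hBm n)] with x hx
    have hx := (hBmem n x).1 hx r hr
    have hn1 : (0 : ℝ) < (n : ℝ) + 1 := by positivity
    have h1 := log_sub_le_abs_add_abs x r
    have h2 : -Real.log ((n : ℝ) + 1) ≤ Real.log (x - r) := by
      rw [← Real.log_inv, ← Real.log_abs (x - r), ← one_div]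
      exact Real.log_le_log (by positivity) hx
    have h3 : 0 ≤ Real.log ((n : ℝ) + 1) := Real.log_nonneg (by linarith [n.cast_nonneg (α := ℝ)])
    rw [Real.norm_eq_abs, abs_le]
    constructor <;> linarith [abs_nonneg x, abs_nonneg r]

end Removal

/-- A Lipschitz vector field on `[0, ∞)` whose flow fixes `0` and the points of `S`. -/
structure IsFlowField {E : Type*} [NormedAddCommGroup E] [MeasurableSpace E] (S : Finset ℝ)
    (h : ℝ → E) (K : ℝ) : Prop where
  measurable : Measurable h
  nonneg : 0 ≤ K
  lipschitz : ∀ x y, 0 ≤ x → 0 ≤ y → ‖h x - h y‖ ≤ K * |x - y|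
  le_mul : ∀ x, 0 ≤ x → ‖h x‖ ≤ K * x
  le_mul_sub : ∀ r ∈ S, ∀ x, 0 ≤ x → ‖h x‖ ≤ K * |x - r|

lemma sub_two_mul_sq_le_log {t : ℝ} (ht : |t| ≤ 1 / 2) : t - 2 * t ^ 2 ≤ Real.log (1 + t) := by
  have h1 := (abs_le.1 ht).1
  have hp : 0 < 1 + t := by linarith
  refine le_trans ?_ (Real.one_sub_inv_le_log_of_pos hp)
  have e : 1 - (1 + t)⁻¹ - (t - 2 * t ^ 2) = t ^ 2 * (1 + 2 * t) / (1 + t) := by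
    field_simp
    ring
  have : 0 ≤ t ^ 2 * (1 + 2 * t) / (1 + t) := by
    have : 0 ≤ 1 + 2 * t := by linarith
    positivity
  linarith

lemma abs_log_one_add_le {t : ℝ} (ht : |t| ≤ 1 / 2) : |Real.log (1 + t)| ≤ 1 := by
  have h1 := abs_le.1 ht
  have h2 := sub_two_mul_sq_le_log ht
  have h3 := Real.log_le_sub_one_of_pos (show 0 < 1 + t by linarith)
  have h4 : t ^ 2 ≤ (1 / 2) ^ 2 := sq_le_sq' (by linarith) h1.2
  rw [abs_le]
  constructor <;> linarith

lemma eq_zero_of_forall_small {D M δ : ℝ} (hδ : 0 < δ)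
    (h : ∀ ε, |ε| ≤ δ → 0 ≤ ε * D + ε ^ 2 * M) : D = 0 := by
  by_contra hD
  have hD' : 0 < |D| := abs_pos.2 hD
  set t := min δ (|D| / (2 * (|M| + 1))) with ht
  have ht0 : 0 < t := lt_min hδ (by positivity)
  have htM : t * (|M| + 1) ≤ |D| / 2 := by
    have : t ≤ |D| / (2 * (|M| + 1)) := min_le_right _ _
    calc t * (|M| + 1) ≤ |D| / (2 * (|M| + 1)) * (|M| + 1) := by gcongr
      _ = |D| / 2 := by field_simp
  have key : t * |D| ≤ t ^ 2 * M := by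
    rcases le_total 0 D with h0 | h0
    · have := h (-t) (by rw [abs_neg, abs_of_pos ht0]; exact min_le_left _ _)
      rw [abs_of_nonneg h0]
      linarith [neg_sq t, this, neg_mul t D]
    · have := h t (by rw [abs_of_pos ht0]; exact min_le_left _ _)
      rw [abs_of_nonpos h0]
      linarith
  have h2 : t ^ 2 * M ≤ t * (t * (|M| + 1)) := by
    rw [sq, mul_assoc]
    gcongr
    linarith [le_abs_self M]
  have h3 : t * (t * (|M| + 1)) ≤ t * (|D| / 2) := by gcongr
  have h4 : 0 < t * |D| := by positivity
  linarith

section Integrability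

variable {E : Type*} [RCLike E] {S : Finset ℝ} {h : ℝ → E} {K : ℝ}
  {μ : Measure ℝ}

lemma ae_prod_nonneg {μ : Measure ℝ} [SFinite μ] (h : μ (Iio 0) = 0) :
    ∀ᵐ p ∂(μ.prod μ), 0 ≤ p.1 ∧ 0 ≤ p.2 := by
  have h1 : ∀ᵐ p ∂(μ.prod μ), 0 ≤ p.1 :=
    Measure.quasiMeasurePreserving_fst.ae (ae_nonneg_of_measure_Iio h)
  have h2 : ∀ᵐ p ∂(μ.prod μ), 0 ≤ p.2 :=
    Measure.quasiMeasurePreserving_snd.ae (ae_nonneg_of_measure_Iio h)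
  filter_upwards [h1, h2] with p h1 h2 using ⟨h1, h2⟩

lemma IsFlowField.norm_div_sub_le (hh : IsFlowField S h K) {r : ℝ} (hr : r ∈ S) {x : ℝ}
    (hx : 0 ≤ x) : ‖h x / ((x : E) - r)‖ ≤ K := by
  rw [norm_div, ← RCLike.ofReal_sub, RCLike.norm_ofReal]
  exact div_le_of_le_mul₀ (abs_nonneg _) hh.nonneg (hh.le_mul_sub r hr x hx)

lemma IsFlowField.norm_slope_le (hh : IsFlowField S h K) {x y : ℝ} (hx : 0 ≤ x) (hy : 0 ≤ y) :
    ‖(h x - h y) / ((x : E) - y)‖ ≤ K := by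
  rw [norm_div, ← RCLike.ofReal_sub, RCLike.norm_ofReal]
  exact div_le_of_le_mul₀ (abs_nonneg _) hh.nonneg (hh.lipschitz x y hx hy)

lemma IsFlowField.integrable (hh : IsFlowField S h K) (hμ : LogAdmissible S μ) :
    Integrable h μ := by
  refine (hμ.mean.const_mul K).mono' hh.measurable.aestronglyMeasurable ?_
  filter_upwards [ae_nonneg_of_measure_Iio hμ.nonneg] with x hx using hh.le_mul x hx

lemma IsFlowField.integrable_div_sub (hh : IsFlowField S h K) (hμ : LogAdmissible S μ) {r : ℝ}
    (hr : r ∈ S) : Integrable (fun x => h x / ((x : E) - r)) μ := by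
  have := hμ.prob
  have := hh.measurable
  refine Integrable.of_bound (Measurable.aestronglyMeasurable (by fun_prop)) K ?_
  filter_upwards [ae_nonneg_of_measure_Iio hμ.nonneg] with x hx using hh.norm_div_sub_le hr hx

lemma IsFlowField.integrable_slope (hh : IsFlowField S h K) (hμ : LogAdmissible S μ) :
    Integrable (fun p : ℝ × ℝ => (h p.1 - h p.2) / ((p.1 : E) - p.2)) (μ.prod μ) := by
  have := hμ.prob
  have := hh.measurable
  refine Integrable.of_bound (Measurable.aestronglyMeasurable (by fun_prop)) K ?_
  filter_upwards [ae_prod_nonneg hμ.nonneg] with p hp using hh.norm_slope_le hp.1 hp.2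

end Integrability

section Flow

variable {S : Finset ℝ} {h : ℝ → ℝ} {K : ℝ} {μ : Measure ℝ}

lemma IsFlowField.flow_nonneg (hh : IsFlowField S h K) {ε : ℝ} (hε : |ε| * K ≤ 1 / 2) {x : ℝ}
    (hx : 0 ≤ x) : 0 ≤ x + ε * h x := by
  have h1 : |ε * h x| ≤ 1 / 2 * x := by
    rw [abs_mul]
    calc |ε| * |h x| ≤ |ε| * (K * x) := by gcongr; exact hh.le_mul x hx
      _ = |ε| * K * x := by ring
      _ ≤ 1 / 2 * x := by gcongr
  linarith [(abs_le.1 h1).1]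

lemma abs_mul_le_half {ε K t : ℝ} (hε : |ε| * K ≤ 1 / 2) (ht : |t| ≤ K) : |ε * t| ≤ 1 / 2 := by
  rw [abs_mul]
  exact (mul_le_mul_of_nonneg_left ht (abs_nonneg _)).trans hε

lemma log_flow_sub {ε x r t : ℝ} (hx : x - r ≠ 0) (ht : |ε * (t / (x - r))| ≤ 1 / 2) :
    Real.log (x + ε * t - r) = Real.log (x - r) + Real.log (1 + ε * (t / (x - r))) := by
  rw [← Real.log_mul hx]
  · congr 1
    field_simp
    ring
  · have := (abs_le.1 ht).1
    linarith

lemma IsFlowField.slope_le (hh : IsFlowField S h K) {x y : ℝ} (hx : 0 ≤ x) (hy : 0 ≤ y) :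
    |(h x - h y) / (x - y)| ≤ K := hh.norm_slope_le hx hy

lemma IsFlowField.injOn_flow (hh : IsFlowField S h K) {ε : ℝ} (hε : |ε| * K ≤ 1 / 2) :
    InjOn (fun x => x + ε * h x) (Ici 0) := by
  intro x hx y hy hxy
  by_contra hne
  have hne : x - y ≠ 0 := sub_ne_zero.2 hne
  have h1 := abs_mul_le_half hε (hh.slope_le hx hy)
  have h2 : 1 + ε * ((h x - h y) / (x - y)) ≠ 0 := by
    have := (abs_le.1 h1).1
    linarith
  refine mul_ne_zero hne h2 ?_
  replace hxy : x + ε * h x = y + ε * h y := hxy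
  field_simp
  linarith

lemma IsFlowField.ae_log_flow_sub (hh : IsFlowField S h K) (hμ : LogAdmissible S μ) {ε : ℝ}
    (hε : |ε| * K ≤ 1 / 2) {r : ℝ} (hr : r ∈ S) :
    ∀ᵐ x ∂μ, |ε * (h x / (x - r))| ≤ 1 / 2 ∧
      Real.log (x + ε * h x - r) = Real.log (x - r) + Real.log (1 + ε * (h x / (x - r))) := by
  have := hμ.noAtoms
  filter_upwards [ae_nonneg_of_measure_Iio hμ.nonneg, ae_forall_ne (ν := μ) S] with x hx hxS
  have h1 := abs_mul_le_half hε (hh.norm_div_sub_le hr hx)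
  exact ⟨h1, log_flow_sub (sub_ne_zero.2 (hxS r hr)) h1⟩

lemma IsFlowField.ae_log_flow_sub_flow (hh : IsFlowField S h K) (hμ : LogAdmissible S μ) {ε : ℝ}
    (hε : |ε| * K ≤ 1 / 2) :
    ∀ᵐ p ∂(μ.prod μ), |ε * ((h p.1 - h p.2) / (p.1 - p.2))| ≤ 1 / 2 ∧
      Real.log ((p.1 + ε * h p.1) - (p.2 + ε * h p.2))
        = Real.log (p.1 - p.2) + Real.log (1 + ε * ((h p.1 - h p.2) / (p.1 - p.2))) := by
  have := hμ.noAtoms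
  have := hμ.prob
  filter_upwards [ae_prod_nonneg hμ.nonneg, ae_prod_sub_ne_zero (ν := μ)] with p hp hpne
  have h1 := abs_mul_le_half hε (hh.slope_le hp.1 hp.2)
  refine ⟨h1, ?_⟩
  rw [← log_flow_sub hpne h1]
  congr 1
  ring

lemma integrable_log_one_add {α : Type*} [MeasurableSpace α] {ν : Measure α} [IsFiniteMeasure ν]
    {g : α → ℝ} (hg : AEStronglyMeasurable g ν) (hb : ∀ᵐ x ∂ν, |g x| ≤ 1 / 2) :
    Integrable (fun x => Real.log (1 + g x)) ν := by
  refine Integrable.of_bound (Real.measurable_log.comp_aemeasurable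
    (hg.aemeasurable.const_add 1)).aestronglyMeasurable 1 ?_
  filter_upwards [hb] with x hx using abs_log_one_add_le hx

lemma le_integral_log_one_add {α : Type*} [MeasurableSpace α] {ν : Measure α}
    [IsProbabilityMeasure ν] {g : α → ℝ} {c : ℝ} (hg : Integrable g ν)
    (hb : ∀ᵐ x ∂ν, |g x| ≤ 1 / 2) (hc : ∀ᵐ x ∂ν, g x ^ 2 ≤ c) :
    ∫ x, g x ∂ν - 2 * c ≤ ∫ x, Real.log (1 + g x) ∂ν := by
  have e : ∫ x, g x ∂ν - 2 * c = ∫ x, (g x - 2 * c) ∂ν := by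
    rw [integral_sub hg (integrable_const _)]; simp
  rw [e]
  refine integral_mono_ae (hg.sub (integrable_const _))
    (integrable_log_one_add hg.aestronglyMeasurable hb) ?_
  filter_upwards [hb, hc] with x hx hcx
  have := sub_two_mul_sq_le_log hx
  linarith

lemma IsFlowField.logAdmissible_map (hh : IsFlowField S h K) (hμ : LogAdmissible S μ) {ε : ℝ}
    (hε : |ε| * K ≤ 1 / 2) : LogAdmissible S (μ.map fun x => x + ε * h x) := by
  have := hμ.noAtoms
  have := hμ.prob
  have hm := hh.measurable
  have hφ : Measurable fun x => x + ε * h x := by fun_prop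
  refine ⟨Measure.isProbabilityMeasure_map hφ.aemeasurable, ?_, ⟨fun y => ?_⟩, ?_, ?_, ?_⟩
  · rw [Measure.map_apply hφ measurableSet_Iio]
    refine measure_mono_null (fun x hx => ?_) hμ.nonneg
    simp only [mem_preimage, mem_Iio] at hx ⊢
    by_contra! h0
    exact absurd hx (not_lt.2 (hh.flow_nonneg hε h0))
  · rw [Measure.map_apply hφ (measurableSet_singleton y)]
    have hsub : ((fun x => x + ε * h x) ⁻¹' {y} ∩ Ici 0).Subsingleton := by
      rintro a ⟨ha, ha0⟩ b ⟨hb, hb0⟩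
      refine hh.injOn_flow hε ha0 hb0 ?_
      simp only [mem_preimage, mem_singleton_iff] at ha hb
      simp only
      rw [ha, hb]
    refine measure_mono_null (fun x hx => ?_)
      (measure_union_null hμ.nonneg (hsub.measure_zero (μ := μ)))
    rcases lt_or_ge x 0 with h0 | h0
    · exact Or.inl h0
    · exact Or.inr ⟨hx, h0⟩
  · rw [integrable_map_measure measurable_id'.aestronglyMeasurable hφ.aemeasurable]
    exact hμ.mean.add ((hh.integrable hμ).const_mul ε)
  · rw [Measure.map_prod_map _ _ hφ hφ, integrable_map_measure
      measurable_log_fst_sub_snd.aestronglyMeasurable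
      (hφ.prodMap hφ).aemeasurable]
    have hae := hh.ae_log_flow_sub_flow hμ hε
    refine (hμ.energy.add (integrable_log_one_add ((hh.integrable_slope hμ).const_mul
      ε).aestronglyMeasurable (hae.mono fun p hp => hp.1))).congr (hae.mono fun p hp => ?_)
    exact hp.2.symm
  · intro r hr
    rw [integrable_map_measure (measurable_log_sub r).aestronglyMeasurable hφ.aemeasurable]
    have hae := hh.ae_log_flow_sub hμ hε hr
    refine ((hμ.log_sub r hr).add (integrable_log_one_add ((hh.integrable_div_sub hμ hr).const_mul
      ε).aestronglyMeasurable (hae.mono fun p hp => hp.1))).congr (hae.mono fun p hp => ?_)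
    exact hp.2.symm

lemma mul_sq_le_sq_mul_sq {ε t K : ℝ} (ht : |t| ≤ K) : (ε * t) ^ 2 ≤ ε ^ 2 * K ^ 2 := by
  rw [mul_pow]
  exact mul_le_mul_of_nonneg_left (sq_le_sq' (by linarith [(abs_le.1 ht).1]) (abs_le.1 ht).2)
    (sq_nonneg ε)

lemma IsFlowField.lagrangian_map_le (hh : IsFlowField S h K) (hμ : LogAdmissible S μ)
    {a l : ℝ} {m : ℝ → ℝ} (hl : 0 ≤ l) (hm : ∀ r ∈ S, 0 ≤ m r) {ε : ℝ}
    (hε : |ε| * K ≤ 1 / 2) :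
    lagrangian a l S m (μ.map fun x => x + ε * h x) ≤ lagrangian a l S m μ
      + (ε * (a * ∫ x, h x ∂μ - ∑ r ∈ S, m r * ∫ x, h x / (x - r) ∂μ
          - l * ∫ p, (h p.1 - h p.2) / (p.1 - p.2) ∂(μ.prod μ))
        + ε ^ 2 * (2 * K ^ 2 * (∑ r ∈ S, m r + l))) := by
  have := hμ.noAtoms
  have := hμ.prob
  have hhm := hh.measurable
  have hφ : Measurable fun x => x + ε * h x := by fun_prop
  have hE : ∫ x, x ∂(μ.map fun x => x + ε * h x) = ∫ x, x ∂μ + ε * ∫ x, h x ∂μ := by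
    rw [integral_map hφ.aemeasurable measurable_id'.aestronglyMeasurable,
      integral_add hμ.mean ((hh.integrable hμ).const_mul ε), integral_const_mul]
  have hI : ∫ p, Real.log (p.1 - p.2) ∂(μ.prod μ)
      + (ε * ∫ p, (h p.1 - h p.2) / (p.1 - p.2) ∂(μ.prod μ) - 2 * (ε ^ 2 * K ^ 2))
      ≤ ∫ p, Real.log (p.1 - p.2) ∂((μ.map fun x => x + ε * h x).prod
        (μ.map fun x => x + ε * h x)) := by
    have hae := hh.ae_log_flow_sub_flow hμ hε
    have hi : Integrable (fun p : ℝ × ℝ => ε * ((h p.1 - h p.2) / (p.1 - p.2))) (μ.prod μ) :=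
      (hh.integrable_slope hμ).const_mul ε
    rw [Measure.map_prod_map _ _ hφ hφ, integral_map (hφ.prodMap hφ).aemeasurable
      measurable_log_fst_sub_snd.aestronglyMeasurable]
    simp only [Prod.map_fst, Prod.map_snd]
    rw [integral_congr_ae (hae.mono fun p hp => hp.2), integral_add hμ.energy
      (integrable_log_one_add hi.aestronglyMeasurable (hae.mono fun p hp => hp.1)),
      ← integral_const_mul]
    refine add_le_add_right ?_ _
    refine le_integral_log_one_add hi (hae.mono fun p hp => hp.1) ?_
    filter_upwards [ae_prod_nonneg hμ.nonneg] with p hp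
    exact mul_sq_le_sq_mul_sq (hh.slope_le hp.1 hp.2)
  have hU : ∀ r ∈ S, ∫ x, Real.log (x - r) ∂μ
      + (ε * ∫ x, h x / (x - r) ∂μ - 2 * (ε ^ 2 * K ^ 2))
      ≤ ∫ x, Real.log (x - r) ∂(μ.map fun x => x + ε * h x) := by
    intro r hr
    have hae := hh.ae_log_flow_sub hμ hε hr
    have hi : Integrable (fun x => ε * (h x / (x - r))) μ :=
      (hh.integrable_div_sub hμ hr).const_mul ε
    rw [integral_map hφ.aemeasurable
      (measurable_log_sub r).aestronglyMeasurable,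
      integral_congr_ae (hae.mono fun p hp => hp.2), integral_add (hμ.log_sub r hr)
      (integrable_log_one_add hi.aestronglyMeasurable (hae.mono fun p hp => hp.1)),
      ← integral_const_mul]
    refine add_le_add_right ?_ _
    refine le_integral_log_one_add hi (hae.mono fun p hp => hp.1) ?_
    filter_upwards [ae_nonneg_of_measure_Iio hμ.nonneg] with x hx
    exact mul_sq_le_sq_mul_sq (hh.norm_div_sub_le hr hx)
  have hI' := mul_le_mul_of_nonneg_left hI hl
  have hU' := Finset.sum_le_sum fun r hr => mul_le_mul_of_nonneg_left (hU r hr) (hm r hr)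
  have e : ∑ r ∈ S, m r * (∫ x, Real.log (x - r) ∂μ
      + (ε * ∫ x, h x / (x - r) ∂μ - 2 * (ε ^ 2 * K ^ 2)))
      = ∑ r ∈ S, m r * ∫ x, Real.log (x - r) ∂μ
        + (ε * ∑ r ∈ S, m r * ∫ x, h x / (x - r) ∂μ - 2 * (ε ^ 2 * K ^ 2) * ∑ r ∈ S, m r) := by
    rw [Finset.mul_sum, Finset.mul_sum, ← Finset.sum_sub_distrib, ← Finset.sum_add_distrib]
    exact Finset.sum_congr rfl fun r _ => by ring
  rw [e] at hU'
  simp only [lagrangian]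
  rw [hE]
  linarith

/-- The Euler-Lagrange equation for the flow along a vector field. -/
lemma IsFlowField.eulerLagrange (hh : IsFlowField S h K) (hμ : LogAdmissible S μ)
    {a l : ℝ} {m : ℝ → ℝ} (hl : 0 ≤ l) (hm : ∀ r ∈ S, 0 ≤ m r)
    (hmin : ∀ ν, LogAdmissible S ν → lagrangian a l S m μ ≤ lagrangian a l S m ν) :
    a * ∫ x, h x ∂μ - ∑ r ∈ S, m r * ∫ x, h x / (x - r) ∂μ
      - l * ∫ p, (h p.1 - h p.2) / (p.1 - p.2) ∂(μ.prod μ) = 0 := by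
  have hK := hh.nonneg
  refine eq_zero_of_forall_small (δ := 1 / (2 * (K + 1)))
    (M := 2 * K ^ 2 * (∑ r ∈ S, m r + l)) (by positivity) fun ε hε => ?_
  have hε' : |ε| * K ≤ 1 / 2 := by
    calc |ε| * K ≤ 1 / (2 * (K + 1)) * (K + 1) := by gcongr; linarith
      _ = 1 / 2 := by field_simp
  have h1 := hmin _ (hh.logAdmissible_map hμ hε')
  have h2 := hh.lagrangian_map_le hμ hl hm hε' (a := a)
  linarith

end Flow

section Complex

lemma integral_complex_re {α : Type*} [MeasurableSpace α] {ν : Measure α} {f : α → ℂ}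
    (hf : Integrable f ν) : ∫ x, (f x).re ∂ν = (∫ x, f x ∂ν).re :=
  Complex.reCLM.integral_comp_comm hf

lemma integral_complex_im {α : Type*} [MeasurableSpace α] {ν : Measure α} {f : α → ℂ}
    (hf : Integrable f ν) : ∫ x, (f x).im ∂ν = (∫ x, f x ∂ν).im :=
  Complex.imCLM.integral_comp_comm hf

variable {S : Finset ℝ} {h : ℝ → ℂ} {K : ℝ} {μ : Measure ℝ}

lemma IsFlowField.re (hh : IsFlowField S h K) : IsFlowField S (fun x => (h x).re) K where
  measurable := Complex.measurable_re.comp hh.measurable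
  nonneg := hh.nonneg
  lipschitz x y hx hy := by
    rw [← Complex.sub_re]
    exact (Complex.abs_re_le_norm _).trans (hh.lipschitz x y hx hy)
  le_mul x hx := (Complex.abs_re_le_norm _).trans (hh.le_mul x hx)
  le_mul_sub r hr x hx := (Complex.abs_re_le_norm _).trans (hh.le_mul_sub r hr x hx)

lemma IsFlowField.im (hh : IsFlowField S h K) : IsFlowField S (fun x => (h x).im) K where
  measurable := Complex.measurable_im.comp hh.measurable
  nonneg := hh.nonneg
  lipschitz x y hx hy := by
    rw [← Complex.sub_im]
    exact (Complex.abs_im_le_norm _).trans (hh.lipschitz x y hx hy)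
  le_mul x hx := (Complex.abs_im_le_norm _).trans (hh.le_mul x hx)
  le_mul_sub r hr x hx := (Complex.abs_im_le_norm _).trans (hh.le_mul_sub r hr x hx)

/-- The Euler-Lagrange equation for a complex-valued field. -/
lemma IsFlowField.eulerLagrange_complex (hh : IsFlowField S h K) (hμ : LogAdmissible S μ)
    {a l : ℝ} {m : ℝ → ℝ} (hl : 0 ≤ l) (hm : ∀ r ∈ S, 0 ≤ m r)
    (hmin : ∀ ν, LogAdmissible S ν → lagrangian a l S m μ ≤ lagrangian a l S m ν) :
    (a : ℂ) * ∫ x, h x ∂μ - ∑ r ∈ S, (m r : ℂ) * ∫ x, h x / ((x : ℂ) - r) ∂μ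
      - (l : ℂ) * ∫ p, (h p.1 - h p.2) / ((p.1 : ℂ) - p.2) ∂(μ.prod μ) = 0 := by
  have h1 := hh.integrable hμ
  have h2 : ∀ r ∈ S, Integrable (fun x => h x / ((x : ℂ) - (r : ℂ))) μ :=
    fun r hr => hh.integrable_div_sub hμ hr
  have h3 : Integrable (fun p : ℝ × ℝ => (h p.1 - h p.2) / ((p.1 : ℂ) - (p.2 : ℂ))) (μ.prod μ) :=
    hh.integrable_slope hμ
  have hre := hh.re.eulerLagrange hμ hl hm hmin
  have him := hh.im.eulerLagrange hμ hl hm hmin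
  have e : ∀ (z : ℂ) (x y : ℝ), (z / ((x : ℂ) - y)).re = z.re / (x - y) ∧
      (z / ((x : ℂ) - y)).im = z.im / (x - y) := fun z x y => by
    rw [← Complex.ofReal_sub, Complex.div_ofReal_re, Complex.div_ofReal_im]
    exact ⟨rfl, rfl⟩
  have hSre : ∑ r ∈ S, m r * (∫ x, h x / ((x : ℂ) - r) ∂μ).re
      = ∑ r ∈ S, m r * ∫ x, (h x).re / (x - r) ∂μ :=
    Finset.sum_congr rfl fun r hr => by
      rw [← integral_complex_re (h2 r hr)]
      simp only [e]
  have hSim : ∑ r ∈ S, m r * (∫ x, h x / ((x : ℂ) - r) ∂μ).im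
      = ∑ r ∈ S, m r * ∫ x, (h x).im / (x - r) ∂μ :=
    Finset.sum_congr rfl fun r hr => by
      rw [← integral_complex_im (h2 r hr)]
      simp only [e]
  apply Complex.ext
  · simp only [Complex.sub_re, Complex.re_sum, Complex.re_ofReal_mul, Complex.zero_re]
    rw [← hre, hSre, ← integral_complex_re h1, ← integral_complex_re h3]
    simp only [e, Complex.sub_re]
  · simp only [Complex.sub_im, Complex.im_sum, Complex.im_ofReal_mul, Complex.zero_im]
    rw [← him, hSim, ← integral_complex_im h1, ← integral_complex_im h3]
    simp only [e, Complex.sub_im]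

end Complex

/-- Bounded Lipschitz functions on `[0, ∞)`. -/
def IsBoundedLipschitz (f : ℝ → ℂ) : Prop :=
  Measurable f ∧ ∃ K, 0 ≤ K ∧ (∀ x, 0 ≤ x → ‖f x‖ ≤ K) ∧
    ∀ x y, 0 ≤ x → 0 ≤ y → ‖f x - f y‖ ≤ K * |x - y|

namespace IsBoundedLipschitz

variable {f g : ℝ → ℂ}

lemma const (c : ℂ) : IsBoundedLipschitz fun _ => c :=
  ⟨measurable_const, ‖c‖, norm_nonneg c, fun _ _ => le_rfl, fun x y _ _ => by
    rw [sub_self, norm_zero]; positivity⟩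

lemma add (hf : IsBoundedLipschitz f) (hg : IsBoundedLipschitz g) :
    IsBoundedLipschitz fun x => f x + g x := by
  obtain ⟨hfm, K, hK, hf1, hf2⟩ := hf
  obtain ⟨hgm, L, hL, hg1, hg2⟩ := hg
  refine ⟨hfm.add hgm, K + L, by positivity,
    fun x hx => (norm_add_le _ _).trans (add_le_add (hf1 x hx) (hg1 x hx)), fun x y hx hy => ?_⟩
  rw [add_sub_add_comm, add_mul]
  exact (norm_add_le _ _).trans (add_le_add (hf2 x y hx hy) (hg2 x y hx hy))

lemma mul (hf : IsBoundedLipschitz f) (hg : IsBoundedLipschitz g) :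
    IsBoundedLipschitz fun x => f x * g x := by
  obtain ⟨hfm, K, hK, hf1, hf2⟩ := hf
  obtain ⟨hgm, L, hL, hg1, hg2⟩ := hg
  refine ⟨hfm.mul hgm, K * L + K * L, by positivity, fun x hx => ?_, fun x y hx hy => ?_⟩
  · rw [norm_mul]
    have := mul_le_mul (hf1 x hx) (hg1 x hx) (norm_nonneg _) hK
    have : 0 ≤ K * L := by positivity
    linarith
  · have e : f x * g x - f y * g y = f x * (g x - g y) + (f x - f y) * g y := by ring
    rw [e, add_mul]
    refine (norm_add_le _ _).trans (add_le_add ?_ ?_)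
    · rw [norm_mul, mul_assoc]
      exact mul_le_mul (hf1 x hx) (hg2 x y hx hy) (norm_nonneg _) hK
    · rw [norm_mul, mul_right_comm]
      exact mul_le_mul (hf2 x y hx hy) (hg1 y hy) (norm_nonneg _) (by positivity)

lemma integrable (hf : IsBoundedLipschitz f) {μ : Measure ℝ} [IsFiniteMeasure μ]
    (hμ : μ (Iio 0) = 0) : Integrable f μ := by
  obtain ⟨hfm, K, hK, hf1, hf2⟩ := hf
  refine Integrable.of_bound hfm.aestronglyMeasurable K ?_
  filter_upwards [ae_nonneg_of_measure_Iio hμ] with x hx using hf1 x hx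

lemma integrable_slope (hf : IsBoundedLipschitz f) {μ : Measure ℝ} [IsFiniteMeasure μ]
    (hμ : μ (Iio 0) = 0) :
    Integrable (fun p : ℝ × ℝ => (f p.1 - f p.2) / ((p.1 : ℂ) - p.2)) (μ.prod μ) := by
  obtain ⟨hfm, K, hK, hf1, hf2⟩ := hf
  refine Integrable.of_bound (Measurable.aestronglyMeasurable (by fun_prop)) K ?_
  filter_upwards [ae_prod_nonneg hμ] with p hp
  rw [norm_div, ← Complex.ofReal_sub, Complex.norm_real]
  exact div_le_of_le_mul₀ (abs_nonneg _) hK (hf2 _ _ hp.1 hp.2)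

end IsBoundedLipschitz

/-- The coordinate `1 / (1 + z)`, which maps `[0, ∞)` to the bounded set `(0, 1]`. -/
noncomputable def invShift (z : ℂ) : ℂ := (1 + z)⁻¹

lemma one_add_ne_zero_of_im {z : ℂ} (hz : z.im ≠ 0) : 1 + z ≠ 0 := by
  intro h
  apply hz
  simpa using congrArg Complex.im h

lemma one_add_ofReal_ne_zero {x : ℝ} (hx : 0 ≤ x) : (1 + x : ℂ) ≠ 0 := by
  have : (1 + x : ℝ) ≠ 0 := by positivity
  exact_mod_cast this

lemma sub_ofReal_ne_zero {z : ℂ} (hz : z.im ≠ 0) (x : ℝ) : z - x ≠ 0 := by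
  intro h
  apply hz
  simpa using congrArg Complex.im h

lemma norm_invShift_ofReal_le {x : ℝ} (hx : 0 ≤ x) : ‖invShift x‖ ≤ 1 := by
  rw [invShift, norm_inv]
  refine inv_le_one_of_one_le₀ ?_
  have : ((1 : ℂ) + x) = ((1 + x : ℝ) : ℂ) := by push_cast; rfl
  rw [this, Complex.norm_real, Real.norm_eq_abs, abs_of_nonneg (by positivity)]
  linarith

lemma measurable_invShift_ofReal : Measurable fun x : ℝ => invShift x :=
  (measurable_const.add Complex.measurable_ofReal).inv

lemma isBoundedLipschitz_invShift : IsBoundedLipschitz fun x => invShift x := by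
  refine ⟨measurable_invShift_ofReal, 1, zero_le_one, fun x hx => norm_invShift_ofReal_le hx,
    fun x y hx hy => ?_⟩
  have e : invShift x - invShift y = invShift x * invShift y * ((y - x : ℝ) : ℂ) := by
    have h1 := one_add_ofReal_ne_zero hx
    have h2 := one_add_ofReal_ne_zero hy
    simp only [invShift]
    push_cast
    field_simp
    ring
  rw [e, norm_mul, norm_mul, Complex.norm_real, Real.norm_eq_abs, abs_sub_comm y x]
  gcongr
  exact mul_le_one₀ (norm_invShift_ofReal_le hx) (norm_nonneg _) (norm_invShift_ofReal_le hy)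

lemma isBoundedLipschitz_aeval_invShift (p : ℝ[X]) :
    IsBoundedLipschitz fun x => aeval (invShift x) p := by
  induction p using Polynomial.induction_on' with
  | add p q hp hq => simpa only [map_add] using hp.add hq
  | monomial n c =>
    induction n with
    | zero => simpa using IsBoundedLipschitz.const (c : ℂ)
    | succ n ih =>
      have := ih.mul isBoundedLipschitz_invShift
      simpa only [aeval_monomial, pow_succ, mul_assoc] using this

lemma isBoundedLipschitz_inv_sub {z : ℂ} (hz : z.im ≠ 0) :
    IsBoundedLipschitz fun x => (z - x)⁻¹ := by
  have hz' : 0 < |z.im| := abs_pos.2 hz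
  have hb : ∀ x : ℝ, ‖(z - x)⁻¹‖ ≤ |z.im|⁻¹ := fun x => by
    rw [norm_inv]
    refine inv_anti₀ hz' ?_
    simpa using Complex.abs_im_le_norm (z - x)
  refine ⟨(measurable_const.sub Complex.measurable_ofReal).inv, |z.im|⁻¹ + |z.im|⁻¹ * |z.im|⁻¹,
    by positivity, fun x _ => (hb x).trans (le_add_of_nonneg_right (by positivity)),
    fun x y _ _ => ?_⟩
  have e : (z - x)⁻¹ - (z - y)⁻¹ = (z - x)⁻¹ * (z - y)⁻¹ * ((x - y : ℝ) : ℂ) := by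
    have h1 := sub_ofReal_ne_zero hz x
    have h2 := sub_ofReal_ne_zero hz y
    push_cast
    field_simp
    ring
  rw [e, norm_mul, norm_mul, Complex.norm_real, Real.norm_eq_abs]
  gcongr
  refine (mul_le_mul (hb x) (hb y) (norm_nonneg _) (by positivity)).trans ?_
  exact le_add_of_nonneg_left (by positivity)

/-- The Stieltjes transform of a measure on the real line. -/
noncomputable def stieltjes (μ : Measure ℝ) (z : ℂ) : ℂ := ∫ x : ℝ, (z - x)⁻¹ ∂μ

/-- For a functional that is linear and real, its value at `p(u) / (z - x)`, where
`u = 1 / (1 + x)` and `v = 1 / (1 + z)`, is `p(v)` times its value at `1 / (z - x)`, up to a real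
polynomial in `v`. -/
lemma exists_aeval_remainder (Λ : (ℝ → ℂ) → ℂ)
    (hadd : ∀ f g, IsBoundedLipschitz f → IsBoundedLipschitz g →
      Λ (fun x => f x + g x) = Λ f + Λ g)
    (hmul : ∀ c f, IsBoundedLipschitz f → Λ (fun x => c * f x) = c * Λ f)
    (hcongr : ∀ f g : ℝ → ℂ, (∀ x, 0 ≤ x → f x = g x) → Λ f = Λ g)
    (hreal : ∀ p : ℝ[X], ∃ c : ℝ, Λ (fun x => aeval (invShift x) p) = c) (p : ℝ[X]) :
    ∃ C : ℝ[X], ∀ z : ℂ, z.im ≠ 0 → Λ (fun x => aeval (invShift x) p * (z - x)⁻¹)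
      = aeval (invShift z) p * Λ (fun x => (z - x)⁻¹) + aeval (invShift z) C := by
  induction p using Polynomial.induction_on' with
  | add p q hp hq =>
    obtain ⟨C, hC⟩ := hp
    obtain ⟨D, hD⟩ := hq
    refine ⟨C + D, fun z hz => ?_⟩
    simp only [map_add, add_mul]
    rw [hadd _ _ ((isBoundedLipschitz_aeval_invShift p).mul (isBoundedLipschitz_inv_sub hz))
      ((isBoundedLipschitz_aeval_invShift q).mul (isBoundedLipschitz_inv_sub hz)), hC z hz, hD z hz]
    ring
  | monomial n c =>
    induction n with
    | zero =>
      refine ⟨0, fun z hz => ?_⟩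
      simp only [monomial_zero_left, aeval_C, map_zero, add_zero]
      exact hmul _ _ (isBoundedLipschitz_inv_sub hz)
    | succ n ih =>
      obtain ⟨D, hD⟩ := ih
      obtain ⟨M, hM⟩ := hreal (monomial (n + 1) c)
      refine ⟨X * D + C M * X, fun z hz => ?_⟩
      have hB1 := (isBoundedLipschitz_aeval_invShift (monomial n c)).mul
        (isBoundedLipschitz_inv_sub hz)
      have hB2 := isBoundedLipschitz_aeval_invShift (monomial (n + 1) c)
      rw [hcongr _ (fun x => invShift z * (aeval (invShift x) (monomial n c) * (z - x)⁻¹)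
        + invShift z * aeval (invShift x) (monomial (n + 1) c)),
        hadd _ _ ((IsBoundedLipschitz.const _).mul hB1) ((IsBoundedLipschitz.const _).mul hB2),
        hmul _ _ hB1, hmul _ _ hB2, hD z hz, hM]
      · simp only [aeval_monomial, map_add, map_mul, aeval_X, aeval_C, Complex.coe_algebraMap]
        ring
      · intro x hx
        have h1 := one_add_ofReal_ne_zero hx
        have h2 := one_add_ne_zero_of_im hz
        have h3 := sub_ofReal_ne_zero hz x
        simp only [aeval_monomial, invShift, pow_succ]
        field_simp
        ring

lemma aeval_invShift_ofReal (p : ℝ[X]) (x : ℝ) :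
    aeval (invShift x) p = ((p.eval ((1 + x)⁻¹) : ℝ) : ℂ) := by
  have : invShift x = algebraMap ℝ ℂ ((1 + x)⁻¹) := by
    simp [invShift]
  rw [this, aeval_algebraMap_apply]
  simp [Polynomial.coe_aeval_eq_eval]

lemma exists_integral_aeval_remainder {μ : Measure ℝ} [IsFiniteMeasure μ] (hμ : μ (Iio 0) = 0)
    (p : ℝ[X]) : ∃ C : ℝ[X], ∀ z : ℂ, z.im ≠ 0 →
      ∫ x : ℝ, aeval (invShift x) p * (z - x)⁻¹ ∂μ
        = aeval (invShift z) p * stieltjes μ z + aeval (invShift z) C := by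
  refine exists_aeval_remainder (fun f => ∫ x, f x ∂μ) ?_ ?_ ?_ ?_ p
  · exact fun f g hf hg => integral_add (hf.integrable hμ) (hg.integrable hμ)
  · exact fun c f _ => integral_const_mul c f
  · intro f g h
    refine integral_congr_ae ?_
    filter_upwards [ae_nonneg_of_measure_Iio hμ] with x hx using h x hx
  · intro p
    refine ⟨∫ x, p.eval ((1 + x)⁻¹) ∂μ, ?_⟩
    simp only [aeval_invShift_ofReal]
    exact integral_ofReal

lemma exists_slope_aeval_remainder {μ : Measure ℝ} [IsFiniteMeasure μ] [NullSingletonClass μ]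
    (hμ : μ (Iio 0) = 0) (p : ℝ[X]) : ∃ C : ℝ[X], ∀ z : ℂ, z.im ≠ 0 →
      ∫ q : ℝ × ℝ, (aeval (invShift q.1) p * (z - q.1)⁻¹ - aeval (invShift q.2) p * (z - q.2)⁻¹)
        / ((q.1 : ℂ) - q.2) ∂(μ.prod μ)
        = aeval (invShift z) p * stieltjes μ z ^ 2 + aeval (invShift z) C := by
  obtain ⟨C, hC⟩ := exists_aeval_remainder
    (fun f => ∫ q : ℝ × ℝ, (f q.1 - f q.2) / ((q.1 : ℂ) - q.2) ∂(μ.prod μ))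
    (fun f g hf hg => by
      rw [← integral_add (hf.integrable_slope hμ) (hg.integrable_slope hμ)]
      refine integral_congr_ae (Filter.Eventually.of_forall fun q => ?_)
      simp only
      ring)
    (fun c f _ => by
      rw [← integral_const_mul]
      refine integral_congr_ae (Filter.Eventually.of_forall fun q => ?_)
      simp only
      ring)
    (fun f g h => by
      refine integral_congr_ae ?_
      filter_upwards [ae_prod_nonneg hμ] with q hq
      rw [h _ hq.1, h _ hq.2])
    (fun p => ⟨∫ q : ℝ × ℝ, (p.eval ((1 + q.1)⁻¹) - p.eval ((1 + q.2)⁻¹)) / (q.1 - q.2)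
        ∂(μ.prod μ), by
      rw [← integral_complex_ofReal]
      simp only [aeval_invShift_ofReal]
      push_cast
      rfl⟩) p
  refine ⟨C, fun z hz => ?_⟩
  rw [hC z hz]
  congr 2
  rw [sq, stieltjes, ← integral_prod_mul]
  refine integral_congr_ae ?_
  filter_upwards [ae_prod_sub_ne_zero (ν := μ)] with q hq
  have h1 := sub_ofReal_ne_zero hz q.1
  have h2 := sub_ofReal_ne_zero hz q.2
  have h3 : (q.1 : ℂ) - q.2 ≠ 0 := by exact_mod_cast hq
  field_simp
  ring

/-- The polynomial in `u = 1 / (1 + x)` that vanishes at `0` and at the points of `S`. -/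
noncomputable def wallPoly (S : Finset ℝ) : ℝ[X] := (1 - X) * ∏ r ∈ S, (1 - C (1 + r) * X)

/-- `wallPoly S` times the derivative of the external field, as a polynomial in `1 / (1 + x)`. -/
noncomputable def fieldPoly (a : ℝ) (S : Finset ℝ) (m : ℝ → ℝ) : ℝ[X] :=
  C a * wallPoly S
    - ∑ r ∈ S, C (m r) * (X * ((1 - X) * ∏ s ∈ S.erase r, (1 - C (1 + s) * X)))

lemma one_sub_invShift {z : ℂ} (hz : 1 + z ≠ 0) : 1 - invShift z = z * invShift z := by
  rw [invShift]
  field_simp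
  ring

lemma one_sub_mul_invShift {z : ℂ} (hz : 1 + z ≠ 0) (r : ℂ) :
    1 - (1 + r) * invShift z = (z - r) * invShift z := by
  rw [invShift]
  field_simp
  ring

lemma aeval_wallPoly (S : Finset ℝ) {z : ℂ} (hz : 1 + z ≠ 0) :
    aeval (invShift z) (wallPoly S) = z * invShift z * ∏ r ∈ S, ((z - r) * invShift z) := by
  simp only [wallPoly, map_mul, map_sub, map_one, aeval_X, map_prod, aeval_C,
    Complex.coe_algebraMap, Complex.ofReal_add, Complex.ofReal_one, one_sub_mul_invShift hz,
    one_sub_invShift hz]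

lemma aeval_fieldPoly (a : ℝ) (S : Finset ℝ) (m : ℝ → ℝ) {z : ℂ} (hz : 1 + z ≠ 0)
    (hS : ∀ r ∈ S, z ≠ r) : aeval (invShift z) (fieldPoly a S m)
      = aeval (invShift z) (wallPoly S) * (a - ∑ r ∈ S, m r / (z - r)) := by
  simp only [fieldPoly, map_sub, map_mul, map_sum, map_one, aeval_X, map_prod, aeval_C,
    Complex.coe_algebraMap, Complex.ofReal_add, Complex.ofReal_one, one_sub_mul_invShift hz,
    one_sub_invShift hz]
  rw [mul_sub, mul_comm (a : ℂ), Finset.mul_sum]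
  congr 1
  refine Finset.sum_congr rfl fun r hr => ?_
  have h1 : z - r ≠ 0 := sub_ne_zero.2 (hS r hr)
  rw [aeval_wallPoly S hz, ← Finset.mul_prod_erase S _ hr]
  field_simp

lemma exists_isFlowField (S : Finset ℝ) {k : ℝ → ℂ} (hk : IsBoundedLipschitz k) :
    ∃ K, IsFlowField S (fun x => aeval (invShift x) (wallPoly S) * k x) K := by
  obtain ⟨hm, L, hL, -, hLip⟩ := (isBoundedLipschitz_aeval_invShift (wallPoly S)).mul hk
  obtain ⟨-, M, hM, hkM, -⟩ := hk
  set B : ℝ → ℝ := fun r => 1 + |1 + r| with hB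
  have hB1 : ∀ r, 1 ≤ B r := fun r => by simp [hB]
  have hBr : ∀ r x : ℝ, 0 ≤ x → ‖((x : ℂ) - r) * invShift x‖ ≤ B r := fun r x hx => by
    rw [← one_sub_mul_invShift (one_add_ofReal_ne_zero hx)]
    refine (norm_sub_le _ _).trans ?_
    rw [norm_one, norm_mul]
    have : ‖(1 + r : ℂ)‖ = |1 + r| := by
      rw [← Complex.ofReal_one, ← Complex.ofReal_add, Complex.norm_real, Real.norm_eq_abs]
    rw [this]
    have := mul_le_mul_of_nonneg_left (norm_invShift_ofReal_le hx) (abs_nonneg (1 + r))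
    simp only [hB]
    linarith
  have hr1 : ∀ r x : ℝ, 0 ≤ x → ‖((x : ℂ) - r) * invShift x‖ ≤ |x - r| := fun r x hx => by
    rw [norm_mul, ← Complex.ofReal_sub, Complex.norm_real, Real.norm_eq_abs]
    exact mul_le_of_le_one_right (abs_nonneg _) (norm_invShift_ofReal_le hx)
  have hx1 : ∀ x : ℝ, 0 ≤ x → ‖(x : ℂ) * invShift x‖ ≤ x := fun x hx => by
    simpa [abs_of_nonneg hx] using hr1 0 x hx
  have hx2 : ∀ x : ℝ, 0 ≤ x → ‖(x : ℂ) * invShift x‖ ≤ 2 := fun x hx => by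
    refine (by simpa using hBr 0 x hx : ‖(x : ℂ) * invShift x‖ ≤ B 0).trans ?_
    simp only [hB]
    norm_num
  have hPB : ∀ s ⊆ S, ∏ r ∈ s, B r ≤ ∏ r ∈ S, B r := fun s hs => by
    rw [← Finset.prod_sdiff hs]
    exact le_mul_of_one_le_left (Finset.prod_nonneg fun r _ => by linarith [hB1 r])
      (by simpa using Finset.prod_le_prod (s := S \ s) (fun _ _ => zero_le_one' ℝ) fun r _ => hB1 r)
  have hprod : ∀ s ⊆ S, ∀ x : ℝ, 0 ≤ x → ‖∏ r ∈ s, (((x : ℂ) - r) * invShift x)‖ ≤ ∏ r ∈ S, B r :=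
    fun s hs x hx => by
      rw [norm_prod]
      exact (Finset.prod_le_prod (fun _ _ => norm_nonneg _) fun r _ => hBr r x hx).trans (hPB s hs)
  set P := ∏ r ∈ S, B r with hP
  have hP0 : 0 ≤ P := Finset.prod_nonneg fun r _ => by linarith [hB1 r]
  refine ⟨L + 2 * (P * M), hm, by positivity, fun x y hx hy => ?_, fun x hx => ?_,
    fun r hr x hx => ?_⟩
  · refine (hLip x y hx hy).trans ?_
    gcongr
    have : 0 ≤ 2 * (P * M) := by positivity
    linarith
  · rw [aeval_wallPoly S (one_add_ofReal_ne_zero hx), norm_mul, norm_mul]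
    calc _ ≤ x * P * M := by
          gcongr
          · exact hx1 x hx
          · exact hprod S subset_rfl x hx
          · exact hkM x hx
      _ = (P * M) * x := by ring
      _ ≤ (L + 2 * (P * M)) * x := by
          have : 0 ≤ P * M := by positivity
          gcongr
          linarith
  · rw [aeval_wallPoly S (one_add_ofReal_ne_zero hx), ← Finset.mul_prod_erase S _ hr, norm_mul,
      norm_mul, norm_mul (((x : ℂ) - r) * invShift x)]
    calc _ ≤ 2 * (|x - r| * P) * M := by
          gcongr
          · exact hx2 x hx
          · exact hr1 r x hx
          · exact hprod _ (Finset.erase_subset _ _) x hx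
          · exact hkM x hx
      _ = 2 * (P * M) * |x - r| := by ring
      _ ≤ (L + 2 * (P * M)) * |x - r| := by
          gcongr
          linarith

section Quadratic

variable {S : Finset ℝ} {μ : Measure ℝ} {a l : ℝ} {m : ℝ → ℝ}

/-- The Euler-Lagrange equation for the field `wallPoly S * k`. -/
lemma LogAdmissible.integral_fieldPoly_mul (hμ : LogAdmissible S μ) (hl : 0 ≤ l)
    (hm : ∀ r ∈ S, 0 ≤ m r)
    (hmin : ∀ ν, LogAdmissible S ν → lagrangian a l S m μ ≤ lagrangian a l S m ν)
    {k : ℝ → ℂ} (hk : IsBoundedLipschitz k) :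
    ∫ x : ℝ, aeval (invShift x) (fieldPoly a S m) * k x ∂μ
      = l * ∫ q : ℝ × ℝ, (aeval (invShift q.1) (wallPoly S) * k q.1
        - aeval (invShift q.2) (wallPoly S) * k q.2) / ((q.1 : ℂ) - q.2) ∂(μ.prod μ) := by
  have := hμ.noAtoms
  obtain ⟨K, hK⟩ := exists_isFlowField S hk
  have h := hK.eulerLagrange_complex hμ hl hm hmin
  rw [sub_eq_zero] at h
  rw [← h, ← integral_const_mul]
  simp only [← integral_const_mul]
  have h1 : Integrable (fun x : ℝ => (a : ℂ) * (aeval (invShift x) (wallPoly S) * k x)) μ :=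
    (hK.integrable hμ).const_mul _
  have h2 : ∀ r ∈ S, Integrable (fun x : ℝ => (m r : ℂ)
      * (aeval (invShift x) (wallPoly S) * k x / ((x : ℂ) - r))) μ :=
    fun r hr => (hK.integrable_div_sub hμ hr).const_mul _
  rw [← integral_finsetSum _ h2, ← integral_sub h1 (integrable_finsetSum _ h2)]
  refine integral_congr_ae ?_
  filter_upwards [ae_nonneg_of_measure_Iio hμ.nonneg, ae_forall_ne (ν := μ) S] with x hx hxS
  rw [aeval_fieldPoly a S m (one_add_ofReal_ne_zero hx)
    fun r hr h => hxS r hr (Complex.ofReal_injective h)]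
  rw [mul_sub, sub_mul, Finset.mul_sum, Finset.sum_mul]
  congr 1
  · ring
  · exact Finset.sum_congr rfl fun r _ => by ring

/-- The quadratic equation for the Stieltjes transform of a minimizer. -/
theorem LogAdmissible.exists_quadratic (hμ : LogAdmissible S μ) (hl : 0 ≤ l)
    (hm : ∀ r ∈ S, 0 ≤ m r)
    (hmin : ∀ ν, LogAdmissible S ν → lagrangian a l S m μ ≤ lagrangian a l S m ν) :
    ∃ C : ℝ[X], ∀ z : ℂ, z.im ≠ 0 →
      l * aeval (invShift z) (wallPoly S) * stieltjes μ z ^ 2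
        - aeval (invShift z) (fieldPoly a S m) * stieltjes μ z + aeval (invShift z) C = 0 := by
  have := hμ.noAtoms
  have := hμ.prob
  obtain ⟨C₁, h₁⟩ := exists_integral_aeval_remainder hμ.nonneg (fieldPoly a S m)
  obtain ⟨C₂, h₂⟩ := exists_slope_aeval_remainder hμ.nonneg (wallPoly S)
  refine ⟨C l * C₂ - C₁, fun z hz => ?_⟩
  have h := hμ.integral_fieldPoly_mul hl hm hmin (isBoundedLipschitz_inv_sub hz)
  rw [h₁ z hz, h₂ z hz] at h
  simp only [map_sub, map_mul, aeval_C, Complex.coe_algebraMap]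
  linear_combination -h

lemma fieldPoly_ne_zero (hm : ∀ r ∈ S, 0 < m r) (ha : 0 ≤ a) (h : 0 < a ∨ S.Nonempty) :
    fieldPoly a S m ≠ 0 := by
  intro h0
  have hev : ∀ᶠ x : ℝ in Filter.atTop, 0 < x ∧ (∀ r ∈ S, r < x) ∧
      (a - ∑ r ∈ S, m r / (x - r)) ≠ 0 := by
    refine (Filter.eventually_gt_atTop 0).and (Filter.Eventually.and ?_ ?_)
    · rw [Finset.eventually_all]
      exact fun r _ => Filter.eventually_gt_atTop r
    · have hlim : Filter.Tendsto (fun x : ℝ => ∑ r ∈ S, m r / (x - r)) Filter.atTop (nhds 0) := by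
        have : Filter.Tendsto (fun x : ℝ => ∑ r ∈ S, m r / (x - r)) Filter.atTop
            (nhds (∑ r ∈ S, 0)) := by
          refine tendsto_finsetSum _ fun r _ => ?_
          exact (Filter.tendsto_atTop_add_const_right _ (-r) Filter.tendsto_id).const_div_atTop _
        simpa using this
      rcases ha.eq_or_lt with ha0 | ha0
      · have hS : S.Nonempty := h.resolve_left (by rw [← ha0]; exact lt_irrefl _)
        have : ∀ᶠ x : ℝ in Filter.atTop, ∀ r ∈ S, r < x := by
          rw [Finset.eventually_all]
          exact fun r _ => Filter.eventually_gt_atTop r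
        filter_upwards [this] with x hx
        rw [← ha0, zero_sub, neg_ne_zero]
        exact (Finset.sum_pos (fun r hr => div_pos (hm r hr) (sub_pos.2 (hx r hr))) hS).ne'
      · filter_upwards [hlim.eventually_lt_const ha0] with x hx
        exact (sub_pos.2 hx).ne'
  obtain ⟨x, hx0, hxS, hx⟩ := hev.exists
  have hx1 := one_add_ofReal_ne_zero hx0.le
  have h1 := aeval_fieldPoly a S m hx1
    fun r hr h => (hxS r hr).ne' (Complex.ofReal_injective h)
  have hu : invShift x ≠ 0 := inv_ne_zero hx1
  rw [h0, map_zero, eq_comm, mul_eq_zero, aeval_wallPoly S hx1, mul_eq_zero, mul_eq_zero] at h1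
  rcases h1 with (h1 | h1) | h1
  · rcases h1 with h1 | h1
    · exact hx0.ne' (Complex.ofReal_injective h1)
    · exact hu h1
  · obtain ⟨r, hr, h2⟩ := Finset.prod_eq_zero_iff.1 h1
    rcases mul_eq_zero.1 h2 with h2 | h2
    · exact (hxS r hr).ne' (Complex.ofReal_injective (sub_eq_zero.1 h2))
    · exact hu h2
  · apply hx
    exact_mod_cast h1

/-- The multiplier of the energy of a minimizer does not vanish. -/
lemma LogAdmissible.energy_multiplier_pos (hμ : LogAdmissible S μ) (ha : 0 ≤ a) (hl : 0 ≤ l)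
    (hm : ∀ r ∈ S, 0 < m r) (h : 0 < a ∨ 0 < l ∨ S.Nonempty)
    (hmin : ∀ ν, LogAdmissible S ν → lagrangian a l S m μ ≤ lagrangian a l S m ν) : 0 < l := by
  have := hμ.noAtoms
  have := hμ.prob
  by_contra! hl0
  obtain rfl : l = 0 := le_antisymm hl0 hl
  have hq := fieldPoly_ne_zero hm ha (h.imp_right fun h => h.resolve_left (lt_irrefl _))
  set q := fieldPoly a S m with hqdef
  have h0 := hμ.integral_fieldPoly_mul le_rfl (fun r hr => (hm r hr).le) hmin
    (isBoundedLipschitz_aeval_invShift q)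
  have hi := ((isBoundedLipschitz_aeval_invShift q).mul
    (isBoundedLipschitz_aeval_invShift q)).integrable hμ.nonneg (μ := μ)
  rw [Complex.ofReal_zero, zero_mul, ← hqdef] at h0
  simp only [aeval_invShift_ofReal, ← Complex.ofReal_mul] at h0 hi
  rw [integral_complex_ofReal, Complex.ofReal_eq_zero,
    integral_eq_zero_iff_of_nonneg (fun x => mul_self_nonneg _) (by simpa using hi.re)] at h0
  have hfin : ({x : ℝ | q.eval ((1 + x)⁻¹) = 0}).Finite := by
    refine Set.Finite.preimage (f := fun x : ℝ => (1 + x)⁻¹) (s := {y | q.eval y = 0})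
      (fun x _ y _ hxy => ?_) (q.finite_setOfPred_isRoot hq)
    simpa using hxy
  have h1 : ∀ᵐ x ∂μ, x ∈ {x : ℝ | q.eval ((1 + x)⁻¹) = 0} := by
    filter_upwards [h0] with x hx
    exact mul_self_eq_zero.1 hx
  have h2 : ∀ᵐ x ∂μ, False := by
    filter_upwards [h1, measure_eq_zero_iff_ae_notMem.1 (hfin.measure_zero μ)] with x h1 h2
      using h2 h1
  exact IsProbabilityMeasure.ne_zero μ (by simpa using h2)

end Quadratic

open Filter Topology

lemma inv_sub_ofReal_im (x y η : ℝ) : (((x : ℂ) + η * Complex.I - y)⁻¹).im = -(η / ((x - y) ^ 2 + η ^ 2)) := by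
  rw [Complex.inv_im, Complex.normSq_apply]
  simp
  ring

lemma integral_poisson {a b y η : ℝ} (hη : 0 < η) :
    ∫ x in a..b, η / ((x - y) ^ 2 + η ^ 2)
      = Real.arctan ((b - y) / η) - Real.arctan ((a - y) / η) := by
  have hd : ∀ x : ℝ, 0 < (x - y) ^ 2 + η ^ 2 := fun x => by positivity
  refine intervalIntegral.integral_eq_sub_of_hasDerivAt
    (f := fun x => Real.arctan ((x - y) / η)) (fun x _ => ?_) ?_
  · have h1 : HasDerivAt (fun x => (x - y) / η) (1 / η) x :=
      ((hasDerivAt_id x).sub_const y).div_const η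
    refine h1.arctan.congr_deriv ?_
    have := hd x
    field_simp
    ring
  · refine Continuous.intervalIntegrable ?_ _ _
    exact continuous_const.div (by fun_prop) fun x => (hd x).ne'

lemma tendsto_arctan_div_of_pos {c : ℝ} (hc : 0 < c) :
    Tendsto (fun η : ℝ => Real.arctan (c / η)) (𝓝[>] 0) (𝓝 (Real.pi / 2)) :=
  (Real.tendsto_arctan_atTop.mono_right nhdsWithin_le_nhds).comp
    (tendsto_inv_nhdsGT_zero.const_mul_atTop hc)

lemma tendsto_arctan_div_of_neg {c : ℝ} (hc : c < 0) :
    Tendsto (fun η : ℝ => Real.arctan (c / η)) (𝓝[>] 0) (𝓝 (-(Real.pi / 2))) :=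
  (Real.tendsto_arctan_atBot.mono_right nhdsWithin_le_nhds).comp
    (tendsto_inv_nhdsGT_zero.const_mul_atTop_of_neg hc)

section Inversion

variable {μ : Measure ℝ} [IsFiniteMeasure μ]

lemma stieltjes_im (x η : ℝ) (hη : 0 < η) :
    (stieltjes μ (x + η * Complex.I)).im = -∫ y, η / ((x - y) ^ 2 + η ^ 2) ∂μ := by
  have hi : Integrable (fun y : ℝ => ((x : ℂ) + η * Complex.I - y)⁻¹) μ := by
    obtain ⟨hm, K, -, -, -⟩ := isBoundedLipschitz_inv_sub (z := (x : ℂ) + η * Complex.I)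
      (by simpa using hη.ne')
    refine Integrable.of_bound hm.aestronglyMeasurable η⁻¹ (Eventually.of_forall fun y => ?_)
    rw [norm_inv]
    refine inv_anti₀ hη ?_
    have := Complex.abs_im_le_norm ((x : ℂ) + η * Complex.I - y)
    simpa [abs_of_pos hη] using this
  rw [stieltjes, ← integral_complex_im hi, ← integral_neg]
  exact integral_congr_ae (Eventually.of_forall fun y => inv_sub_ofReal_im x y η)

lemma stieltjes_im_nonpos (x η : ℝ) (hη : 0 < η) :
    (stieltjes μ (x + η * Complex.I)).im ≤ 0 := by
  rw [stieltjes_im x η hη, neg_nonpos]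
  exact integral_nonneg fun y => by positivity

lemma poisson_le {x y η : ℝ} (hη : 0 < η) : ‖η / ((x - y) ^ 2 + η ^ 2)‖ ≤ η⁻¹ := by
  rw [Real.norm_eq_abs, abs_of_nonneg (by positivity), div_le_iff₀ (by positivity)]
  have : η⁻¹ * ((x - y) ^ 2 + η ^ 2) = η⁻¹ * (x - y) ^ 2 + η := by field_simp
  rw [this]
  have : 0 ≤ η⁻¹ * (x - y) ^ 2 := by positivity
  linarith

lemma integral_stieltjes_im {a b η : ℝ} (hab : a ≤ b) (hη : 0 < η) :
    ∫ x in a..b, -(stieltjes μ (x + η * Complex.I)).im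
      = ∫ y, (Real.arctan ((b - y) / η) - Real.arctan ((a - y) / η)) ∂μ := by
  simp only [stieltjes_im _ _ hη, neg_neg, ← integral_poisson hη]
  simp only [intervalIntegral.integral_of_le hab]
  refine integral_integral_swap ?_
  refine Integrable.of_bound ?_ η⁻¹ (Eventually.of_forall fun p => poisson_le hη)
  refine Continuous.aestronglyMeasurable ?_
  simp only [Function.uncurry_def]
  exact continuous_const.div (by fun_prop) fun p => by positivity

lemma tendsto_integral_stieltjes_im [NullSingletonClass μ] {a b : ℝ} (hab : a ≤ b) :
    Tendsto (fun η : ℝ => ∫ x in a..b, -(stieltjes μ (x + η * Complex.I)).im) (𝓝[>] 0)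
      (𝓝 (Real.pi * μ.real (Ioo a b))) := by
  have h1 : ∫ y, (Ioo a b).indicator (fun _ => Real.pi) y ∂μ = Real.pi * μ.real (Ioo a b) := by
    rw [integral_indicator measurableSet_Ioo, setIntegral_const, smul_eq_mul, mul_comm]
  rw [← h1]
  have h2 : Tendsto (fun η : ℝ =>
      ∫ y, (Real.arctan ((b - y) / η) - Real.arctan ((a - y) / η)) ∂μ) (𝓝[>] 0)
      (𝓝 (∫ y, (Ioo a b).indicator (fun _ => Real.pi) y ∂μ)) := by
    refine tendsto_integral_filter_of_dominated_convergence (fun _ => Real.pi)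
      (Eventually.of_forall fun η => ?_) (Eventually.of_forall fun η => ?_)
      (integrable_const _) ?_
    · refine Measurable.aestronglyMeasurable ?_
      exact (Real.measurable_arctan.comp (by fun_prop)).sub
        (Real.measurable_arctan.comp (by fun_prop))
    · refine Eventually.of_forall fun y => ?_
      rw [Real.norm_eq_abs, abs_le]
      have h1 := Real.arctan_mem_Ioo ((b - y) / η)
      have h2 := Real.arctan_mem_Ioo ((a - y) / η)
      constructor <;> linarith [h1.1, h1.2, h2.1, h2.2]
    · filter_upwards [ae_forall_ne (ν := μ) {a, b}] with y hy
      have hya : y ≠ a := hy a (by simp)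
      have hyb : y ≠ b := hy b (by simp)
      rcases lt_or_gt_of_ne hya with h1 | h1
      · have e : (Ioo a b).indicator (fun _ => Real.pi) y = Real.pi / 2 - Real.pi / 2 := by
          rw [indicator_of_notMem (fun h => lt_asymm h1 h.1), sub_self]
        rw [e]
        exact (tendsto_arctan_div_of_pos (by linarith)).sub
          (tendsto_arctan_div_of_pos (by linarith))
      · rcases lt_or_gt_of_ne hyb with h2 | h2
        · have e : (Ioo a b).indicator (fun _ => Real.pi) y = Real.pi / 2 - -(Real.pi / 2) := by
            rw [indicator_of_mem (show y ∈ Ioo a b from ⟨h1, h2⟩)]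
            ring
          rw [e]
          exact (tendsto_arctan_div_of_pos (by linarith)).sub
            (tendsto_arctan_div_of_neg (by linarith))
        · have e : (Ioo a b).indicator (fun _ => Real.pi) y
              = -(Real.pi / 2) - -(Real.pi / 2) := by
            rw [indicator_of_notMem (fun h => lt_asymm h2 h.2), sub_self]
          rw [e]
          exact (tendsto_arctan_div_of_neg (by linarith)).sub
            (tendsto_arctan_div_of_neg (by linarith))
  refine h2.congr' ?_
  filter_upwards [self_mem_nhdsWithin] with η hη
  exact (integral_stieltjes_im hab hη).symm

/-- Stieltjes inversion on an interval where the transform has bounded boundary values. -/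
lemma measure_Ioo_eq_of_tendsto_stieltjes [NullSingletonClass μ] {a b M : ℝ} {g : ℝ → ℝ}
    (hab : a ≤ b) (hg : ContinuousOn g (Icc a b)) (hg0 : ∀ x ∈ Icc a b, 0 ≤ g x)
    (hb : ∀ x ∈ Icc a b, ∀ η ∈ Ioc (0 : ℝ) 1, |(stieltjes μ (x + η * Complex.I)).im| ≤ M)
    (hlim : ∀ x ∈ Icc a b, Tendsto (fun η : ℝ => -(stieltjes μ (x + η * Complex.I)).im) (𝓝[>] 0)
      (𝓝 (Real.pi * g x))) :
    μ (Ioo a b) = ∫⁻ x in Ioo a b, ENNReal.ofReal (g x) := by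
  have h1 : Tendsto (fun η : ℝ => ∫ x in a..b, -(stieltjes μ (x + η * Complex.I)).im) (𝓝[>] 0)
      (𝓝 (∫ x in a..b, Real.pi * g x)) := by
    refine intervalIntegral.tendsto_integral_filter_of_dominated_convergence (fun _ => M) ?_ ?_
      intervalIntegrable_const ?_
    · filter_upwards [self_mem_nhdsWithin] with η hη
      have hη : 0 < η := hη
      simp only [stieltjes_im _ _ hη, neg_neg]
      refine (StronglyMeasurable.integral_prod_right ?_).aestronglyMeasurable
      refine Continuous.stronglyMeasurable ?_
      simp only [Function.uncurry_def]
      exact continuous_const.div (by fun_prop) fun p => by positivity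
    · filter_upwards [Ioc_mem_nhdsGT (zero_lt_one' ℝ)] with η hη
      refine Eventually.of_forall fun x hx => ?_
      rw [uIoc_of_le hab] at hx
      rw [norm_neg]
      exact hb x (Ioc_subset_Icc_self hx) η hη
    · refine Eventually.of_forall fun x hx => ?_
      rw [uIoc_of_le hab] at hx
      exact hlim x (Ioc_subset_Icc_self hx)
  have h2 := tendsto_nhds_unique h1 (tendsto_integral_stieltjes_im hab)
  rw [intervalIntegral.integral_const_mul, mul_right_inj' Real.pi_pos.ne',
    intervalIntegral.integral_of_le hab, integral_Ioc_eq_integral_Ioo] at h2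
  rw [← ofReal_integral_eq_lintegral_ofReal, h2, ofReal_measureReal]
  · exact hg.integrableOn_Icc.mono_set Ioo_subset_Icc_self
  · refine (ae_restrict_iff' measurableSet_Ioo).2 (Eventually.of_forall fun x hx => ?_)
    exact hg0 x (Ioo_subset_Icc_self hx)

end Inversion

lemma sq_im_eq (w : ℂ) : w.im ^ 2 = (‖w ^ 2‖ - (w ^ 2).re) / 2 := by
  rw [norm_pow, ← Complex.normSq_eq_norm_sq, Complex.normSq_apply, sq w, Complex.mul_re]
  ring

/-- The imaginary part of a root with `Im F ≤ 0` of a quadratic equation with asymptotically real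
coefficients converges. -/
lemma tendsto_neg_im_of_quadratic {ι : Type*} {L : Filter ι} {P q c F : ι → ℂ} {P₀ q₀ c₀ : ℝ}
    (hP : Tendsto P L (𝓝 P₀)) (hq : Tendsto q L (𝓝 q₀)) (hc : Tendsto c L (𝓝 c₀))
    (hP₀ : P₀ ≠ 0) (hF : ∀ᶠ i in L, P i * F i ^ 2 - q i * F i + c i = 0)
    (him : ∀ᶠ i in L, (F i).im ≤ 0) :
    Tendsto (fun i => -(F i).im) L
      (𝓝 (Real.sqrt (max ((4 * P₀ * c₀ - q₀ ^ 2) / (4 * P₀ ^ 2)) 0))) := by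
  have hP0 : (P₀ : ℂ) ≠ 0 := by exact_mod_cast hP₀
  have hPne : ∀ᶠ i in L, P i ≠ 0 := hP.eventually_ne hP0
  set w : ι → ℂ := fun i => F i - q i / (2 * P i) with hw
  have hG1 : Tendsto (fun i => q i / (2 * P i)) L (𝓝 ((q₀ : ℂ) / (2 * P₀))) :=
    hq.div (hP.const_mul 2) (mul_ne_zero two_ne_zero hP0)
  have hG2 : Tendsto (fun i => (q i ^ 2 - 4 * P i * c i) / (4 * P i ^ 2)) L
      (𝓝 (((q₀ : ℂ) ^ 2 - 4 * P₀ * c₀) / (4 * P₀ ^ 2))) :=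
    ((hq.pow 2).sub ((hP.const_mul 4).mul hc)).div ((hP.pow 2).const_mul 4)
      (mul_ne_zero (by norm_num) (pow_ne_zero 2 hP0))
  have hw2 : Tendsto (fun i => w i ^ 2) L (𝓝 (((q₀ : ℂ) ^ 2 - 4 * P₀ * c₀) / (4 * P₀ ^ 2))) := by
    refine hG2.congr' ?_
    filter_upwards [hPne, hF] with i hi hFi
    simp only [hw]
    field_simp
    linear_combination (-16 * P i) * hFi
  set ρ : ℝ := (q₀ ^ 2 - 4 * P₀ * c₀) / (4 * P₀ ^ 2) with hρ
  have hρ' : ((q₀ : ℂ) ^ 2 - 4 * P₀ * c₀) / (4 * P₀ ^ 2) = (ρ : ℂ) := by rw [hρ]; push_cast; rfl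
  rw [hρ'] at hw2
  have hmax : (4 * P₀ * c₀ - q₀ ^ 2) / (4 * P₀ ^ 2) = -ρ := by rw [hρ, ← neg_div]; ring
  rw [hmax]
  have him2 : Tendsto (fun i => |(w i).im|) L (𝓝 (Real.sqrt (max (-ρ) 0))) := by
    have h1 : Tendsto (fun i => (‖w i ^ 2‖ - (w i ^ 2).re) / 2) L
        (𝓝 ((‖(ρ : ℂ)‖ - (ρ : ℂ).re) / 2)) :=
      (hw2.norm.sub ((Complex.continuous_re.tendsto _).comp hw2)).div_const 2
    have h2 : (‖(ρ : ℂ)‖ - (ρ : ℂ).re) / 2 = max (-ρ) 0 := by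
      rw [Complex.norm_real, Complex.ofReal_re, Real.norm_eq_abs]
      rcases le_total 0 ρ with h | h
      · rw [abs_of_nonneg h, max_eq_right (by linarith)]; ring
      · rw [abs_of_nonpos h, max_eq_left (by linarith)]; ring
    rw [h2] at h1
    refine ((Real.continuous_sqrt.tendsto _).comp h1).congr fun i => ?_
    simp only [Function.comp_apply]
    rw [← sq_im_eq, Real.sqrt_sq_eq_abs]
  have him3 : Tendsto (fun i => (q i / (2 * P i)).im) L (𝓝 0) := by
    have := (Complex.continuous_im.tendsto _).comp hG1
    have e : ((q₀ : ℂ) / (2 * P₀)).im = 0 := by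
      have : ((q₀ : ℂ) / (2 * P₀)) = ((q₀ / (2 * P₀) : ℝ) : ℂ) := by push_cast; rfl
      rw [this, Complex.ofReal_im]
    rwa [e] at this
  have hdiff : Tendsto (fun i => -(F i).im - |(w i).im|) L (𝓝 0) := by
    refine squeeze_zero_norm' ?_ (by simpa using him3.abs)
    filter_upwards [him] with i hi
    rw [Real.norm_eq_abs]
    have e : (w i).im = (F i).im - (q i / (2 * P i)).im := by simp [hw]
    rw [e, ← abs_of_nonpos hi]
    refine (abs_abs_sub_abs_le _ _).trans ?_
    simp
  simpa using hdiff.add him2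

lemma norm_le_of_quadratic {P q c F : ℂ} (hP : P ≠ 0) (hF : P * F ^ 2 - q * F + c = 0) :
    ‖F‖ ≤ ‖q / (2 * P)‖ + Real.sqrt ‖(q ^ 2 - 4 * P * c) / (4 * P ^ 2)‖ := by
  have e : (F - q / (2 * P)) ^ 2 = (q ^ 2 - 4 * P * c) / (4 * P ^ 2) := by
    field_simp
    linear_combination (16 * P) * hF
  rw [← e, norm_pow, Real.sqrt_sq (norm_nonneg _)]
  have := norm_add_le (q / (2 * P)) (F - q / (2 * P))
  simpa using this

/-- The density of a minimizer, read off from the discriminant of its quadratic equation. -/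
noncomputable def discriminantDensity (P q c : ℝ[X]) (t : ℝ) : ℝ :=
  Real.pi⁻¹ * Real.sqrt (max ((4 * P.eval ((1 + t)⁻¹) * c.eval ((1 + t)⁻¹)
    - q.eval ((1 + t)⁻¹) ^ 2) / (4 * P.eval ((1 + t)⁻¹) ^ 2)) 0)

lemma discriminantDensity_nonneg (P q c : ℝ[X]) (t : ℝ) : 0 ≤ discriminantDensity P q c t :=
  mul_nonneg (inv_nonneg.2 Real.pi_pos.le) (Real.sqrt_nonneg _)

lemma continuousAt_eval_invShift (p : ℝ[X]) {t : ℝ} (ht : 0 < t) :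
    ContinuousAt (fun x : ℝ => p.eval ((1 + x)⁻¹)) t := by
  have h1 : ContinuousAt (fun x : ℝ => (1 + x)⁻¹) t :=
    ContinuousAt.inv₀ (by fun_prop) (by positivity)
  exact p.continuous.continuousAt.comp' h1

lemma continuousOn_discriminantDensity {P q c : ℝ[X]}
    (h : ∀ t : ℝ, 0 < t → P.eval ((1 + t)⁻¹) = 0 → q.eval ((1 + t)⁻¹) ≠ 0) :
    ContinuousOn (discriminantDensity P q c) (Ioi 0) := by
  intro t ht
  have ht : 0 < t := ht
  refine ContinuousAt.continuousWithinAt ?_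
  have hP := continuousAt_eval_invShift P ht
  have hq := continuousAt_eval_invShift q ht
  have hc := continuousAt_eval_invShift c ht
  have hnum : ContinuousAt (fun x : ℝ => 4 * P.eval ((1 + x)⁻¹) * c.eval ((1 + x)⁻¹)
      - q.eval ((1 + x)⁻¹) ^ 2) t := ((hP.const_mul 4).mul hc).sub (hq.pow 2)
  by_cases h0 : P.eval ((1 + t)⁻¹) = 0
  · have hneg : ∀ᶠ x in 𝓝 t, 4 * P.eval ((1 + x)⁻¹) * c.eval ((1 + x)⁻¹)
        - q.eval ((1 + x)⁻¹) ^ 2 < 0 := by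
      refine hnum.eventually_lt_const ?_
      beta_reduce
      rw [h0]
      have := pow_pos (abs_pos.2 (h t ht h0)) 2
      rw [sq_abs] at this
      linarith
    have hz : ∀ᶠ x in 𝓝 t, (0 : ℝ) = discriminantDensity P q c x := by
      filter_upwards [hneg] with x hx
      rw [discriminantDensity, max_eq_right (div_nonpos_of_nonpos_of_nonneg hx.le (by positivity)),
        Real.sqrt_zero, mul_zero]
    exact continuousAt_const.congr hz
  · unfold discriminantDensity
    refine ContinuousAt.mul continuousAt_const (ContinuousAt.sqrt (ContinuousAt.sup ?_
      continuousAt_const))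
    exact hnum.div ((hP.pow 2).const_mul 4) (by positivity)

lemma aeval_wallPoly_ne_zero {S : Finset ℝ} {z : ℂ} (h1 : 1 + z ≠ 0) (h0 : z ≠ 0)
    (hS : ∀ r ∈ S, z ≠ r) : aeval (invShift z) (wallPoly S) ≠ 0 := by
  have hu : invShift z ≠ 0 := inv_ne_zero h1
  rw [aeval_wallPoly S h1]
  exact mul_ne_zero (mul_ne_zero h0 hu)
    (Finset.prod_ne_zero_iff.2 fun r hr => mul_ne_zero (sub_ne_zero.2 (hS r hr)) hu)

lemma eval_wallPoly_ne_zero {S : Finset ℝ} {t : ℝ} (ht : 0 < t) (hS : t ∉ S) :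
    (wallPoly S).eval ((1 + t)⁻¹) ≠ 0 := by
  have := aeval_wallPoly_ne_zero (S := S) (one_add_ofReal_ne_zero ht.le)
    (Complex.ofReal_ne_zero.2 ht.ne') fun r hr h => hS (Complex.ofReal_injective h ▸ hr)
  rw [aeval_invShift_ofReal] at this
  exact_mod_cast this

lemma eval_fieldPoly_ne_zero {a : ℝ} {S : Finset ℝ} {m : ℝ → ℝ} {t : ℝ} (ht : 0 < t)
    (hS : t ∈ S) (hm : m t ≠ 0) : (fieldPoly a S m).eval ((1 + t)⁻¹) ≠ 0 := by
  have h1 : (1 + t) ≠ 0 := by positivity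
  have hfac : ∀ r : ℝ, 1 - (1 + r) * (1 + t)⁻¹ = (t - r) * (1 + t)⁻¹ := fun r => by
    field_simp
    ring
  have hfac0 : 1 - (1 + t)⁻¹ = t * (1 + t)⁻¹ := by
    field_simp
    ring
  have hwall : (wallPoly S).eval ((1 + t)⁻¹) = 0 := by
    simp only [wallPoly, eval_mul, eval_sub, eval_one, eval_X, eval_prod, eval_C]
    rw [Finset.prod_eq_zero hS (by rw [hfac]; ring), mul_zero]
  simp only [fieldPoly, eval_sub, eval_mul, eval_finsetSum, eval_one, eval_X, eval_prod, eval_C]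
  rw [hwall, mul_zero, zero_sub, neg_ne_zero, Finset.sum_eq_single_of_mem t hS]
  · refine mul_ne_zero hm (mul_ne_zero (inv_ne_zero h1) (mul_ne_zero ?_ ?_))
    · rw [hfac0]
      positivity
    · refine Finset.prod_ne_zero_iff.2 fun r hr => ?_
      rw [hfac]
      exact mul_ne_zero (sub_ne_zero.2 (Finset.ne_of_mem_erase hr).symm) (inv_ne_zero h1)
  · intro r _ hrt
    rw [Finset.prod_eq_zero (Finset.mem_erase.2 ⟨hrt.symm, hS⟩) (by rw [hfac]; ring)]
    ring

section Density

variable {μ : Measure ℝ} {S : Finset ℝ} {l : ℝ} {q c : ℝ[X]}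

lemma continuousAt_aeval_invShift (p : ℝ[X]) {z : ℂ} (hz : 1 + z ≠ 0) :
    ContinuousAt (fun z => aeval (invShift z) p) z := by
  have h1 : ContinuousAt invShift z := ContinuousAt.inv₀ (by fun_prop) hz
  exact (p.continuous_aeval (A := ℂ)).continuousAt.comp' h1

lemma tendsto_aeval_invShift (p : ℝ[X]) {t : ℝ} (ht : 0 < t) :
    Tendsto (fun η : ℝ => aeval (invShift (t + η * Complex.I)) p) (𝓝[>] 0)
      (𝓝 ((p.eval ((1 + t)⁻¹) : ℝ) : ℂ)) := by
  rw [← aeval_invShift_ofReal]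
  have h1 : Tendsto (fun η : ℝ => (t : ℂ) + η * Complex.I) (𝓝[>] 0) (𝓝 (t : ℂ)) := by
    have : Continuous fun η : ℝ => (t : ℂ) + η * Complex.I := by fun_prop
    have h2 := (this.tendsto 0).mono_left (nhdsWithin_le_nhds (s := Ioi 0))
    simpa using h2
  exact (continuousAt_aeval_invShift p (one_add_ofReal_ne_zero ht.le)).tendsto.comp h1

/-- The set of points where the density is read off from the quadratic equation. -/
def regularSet (S : Finset ℝ) : Set ℝ := Ioi 0 \ S

lemma measure_Ioo_eq_of_quadratic [IsFiniteMeasure μ] [NullSingletonClass μ] (hl : 0 < l)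
    (hquad : ∀ z : ℂ, z.im ≠ 0 → l * aeval (invShift z) (wallPoly S) * stieltjes μ z ^ 2
        - aeval (invShift z) q * stieltjes μ z + aeval (invShift z) c = 0)
    {a b : ℝ} (hab : a ≤ b) (hsub : Icc a b ⊆ regularSet S)
    (hcont : ContinuousOn (discriminantDensity (C l * wallPoly S) q c) (Ioi 0)) :
    μ (Ioo a b) = ∫⁻ x in Ioo a b,
      ENNReal.ofReal (discriminantDensity (C l * wallPoly S) q c x) := by
  have him : ∀ (x η : ℝ), 0 < η → ((x : ℂ) + η * Complex.I).im ≠ 0 := fun x η hη => by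
    simpa using hη.ne'
  have hre : ∀ p ∈ Icc a b ×ˢ Icc (0 : ℝ) 1, 1 + ((p.1 : ℂ) + p.2 * Complex.I) ≠ 0 ∧
      aeval (invShift ((p.1 : ℂ) + p.2 * Complex.I)) (wallPoly S) ≠ 0 := by
    rintro ⟨x, η⟩ ⟨hx, hη⟩
    have hx' := hsub hx
    have hx0 : 0 < x := hx'.1
    have hrp : ∀ y : ℝ, (x : ℂ) + η * Complex.I = y → x = y := fun y h => by
      simpa using congrArg Complex.re h
    have h1 : (1 : ℂ) + ((x : ℂ) + η * Complex.I) ≠ 0 := fun h => by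
      have := congrArg Complex.re h
      simp at this
      linarith
    refine ⟨h1, aeval_wallPoly_ne_zero h1 (fun h => ?_) fun r hr h => ?_⟩
    · exact hx0.ne' (hrp 0 (by simpa using h))
    · exact hx'.2 (by rw [hrp r h]; exact hr)
  have hmap : ∀ p : ℝ[X], ContinuousOn
      (fun x : ℝ × ℝ => aeval (invShift ((x.1 : ℂ) + x.2 * Complex.I)) p)
      (Icc a b ×ˢ Icc (0 : ℝ) 1) := fun p x hx => by
    have h1 : ContinuousAt (fun x : ℝ × ℝ => (x.1 : ℂ) + x.2 * Complex.I) x := by fun_prop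
    exact (ContinuousAt.comp' (f := fun x : ℝ × ℝ => (x.1 : ℂ) + x.2 * Complex.I)
      (continuousAt_aeval_invShift p (hre x hx).1) h1).continuousWithinAt
  have hl' : (l : ℂ) ≠ 0 := Complex.ofReal_ne_zero.2 hl.ne'
  have hG : ContinuousOn (fun x : ℝ × ℝ =>
      ‖aeval (invShift ((x.1 : ℂ) + x.2 * Complex.I)) q
        / (2 * (l * aeval (invShift ((x.1 : ℂ) + x.2 * Complex.I)) (wallPoly S)))‖
      + Real.sqrt ‖(aeval (invShift ((x.1 : ℂ) + x.2 * Complex.I)) q ^ 2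
        - 4 * (l * aeval (invShift ((x.1 : ℂ) + x.2 * Complex.I)) (wallPoly S))
          * aeval (invShift ((x.1 : ℂ) + x.2 * Complex.I)) c)
        / (4 * (l * aeval (invShift ((x.1 : ℂ) + x.2 * Complex.I)) (wallPoly S)) ^ 2)‖)
      (Icc a b ×ˢ Icc (0 : ℝ) 1) := by
    have hP := (hmap (wallPoly S)).const_mul (l : ℂ)
    refine ContinuousOn.add (ContinuousOn.norm ((hmap q).div (hP.const_mul 2) fun x hx => ?_))
      (ContinuousOn.sqrt (ContinuousOn.norm ((((hmap q).pow 2).sub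
        ((hP.const_mul 4).mul (hmap c))).div ((hP.pow 2).const_mul 4) fun x hx => ?_)))
    · exact mul_ne_zero two_ne_zero (mul_ne_zero hl' (hre x hx).2)
    · exact mul_ne_zero (by norm_num) (pow_ne_zero 2 (mul_ne_zero hl' (hre x hx).2))
  obtain ⟨M, hM⟩ := (isCompact_Icc.prod isCompact_Icc).exists_bound_of_continuousOn hG
  refine measure_Ioo_eq_of_tendsto_stieltjes (M := M) hab
    (hcont.mono fun x hx => (hsub hx).1) (fun x _ => discriminantDensity_nonneg _ _ _ x) ?_ ?_
  · intro x hx η hη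
    have hp : (x, η) ∈ Icc a b ×ˢ Icc (0 : ℝ) 1 := ⟨hx, Ioc_subset_Icc_self hη⟩
    refine (Complex.abs_im_le_norm _).trans ?_
    refine (norm_le_of_quadratic (mul_ne_zero hl' (hre _ hp).2)
      (hquad _ (him x η hη.1))).trans ?_
    exact (le_abs_self _).trans (hM _ hp)
  · intro x hx
    have hx0 : 0 < x := (hsub hx).1
    have hP : Tendsto (fun η : ℝ => (l : ℂ) * aeval (invShift (x + η * Complex.I)) (wallPoly S))
        (𝓝[>] 0) (𝓝 (((C l * wallPoly S).eval ((1 + x)⁻¹) : ℝ) : ℂ)) := by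
      rw [eval_mul, eval_C, Complex.ofReal_mul]
      exact (tendsto_aeval_invShift (wallPoly S) hx0).const_mul _
    have hlim := tendsto_neg_im_of_quadratic hP (tendsto_aeval_invShift q hx0)
      (tendsto_aeval_invShift c hx0) ?_ ?_ ?_ (F := fun η : ℝ => stieltjes μ (x + η * Complex.I))
    · rw [discriminantDensity, mul_inv_cancel_left₀ Real.pi_pos.ne']
      exact hlim
    · rw [eval_mul, eval_C]
      exact mul_ne_zero hl.ne' (eval_wallPoly_ne_zero hx0 (hsub hx).2)
    · filter_upwards [self_mem_nhdsWithin] with η hη using hquad _ (him x η hη)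
    · filter_upwards [self_mem_nhdsWithin] with η hη using stieltjes_im_nonpos x η hη

/-- Two measures on the line agree if they agree on the small intervals in an open set of full
measure. -/
lemma measure_eq_of_Ioo_eq {μ ν : Measure ℝ} [IsFiniteMeasure μ] {O : Set ℝ} (hO : IsOpen O)
    (hμ : μ Oᶜ = 0) (hν : ν Oᶜ = 0)
    (h : ∀ a b, a ≤ b → Icc a b ⊆ O → μ (Ioo a b) = ν (Ioo a b)) : μ = ν := by
  set I : Set (ℚ × ℚ) := {i | Icc (i.1 : ℝ) i.2 ⊆ O} with hI
  have hU : (⋃ i ∈ I, Ioo (i.1 : ℝ) i.2) = O := by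
    refine subset_antisymm (iUnion₂_subset fun i hi => Ioo_subset_Icc_self.trans hi) fun x hx => ?_
    obtain ⟨ε, hε, hball⟩ := Metric.isOpen_iff.1 hO x hx
    obtain ⟨a, ha1, ha2⟩ := exists_rat_btwn (show x - ε < x by linarith)
    obtain ⟨b, hb1, hb2⟩ := exists_rat_btwn (show x < x + ε by linarith)
    refine mem_iUnion₂.2 ⟨(a, b), ?_, ha2, hb1⟩
    refine fun y hy => hball ?_
    rw [Metric.mem_ball, Real.dist_eq, abs_lt]
    constructor <;> linarith [hy.1, hy.2]
  have hres : μ.restrict O = ν.restrict O := by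
    rw [← hU, Measure.restrict_biUnion_congr (to_countable I)]
    intro i hi
    refine Real.measure_ext_Ioo_rat fun c d => ?_
    rw [Measure.restrict_apply measurableSet_Ioo, Measure.restrict_apply measurableSet_Ioo,
      Ioo_inter_Ioo]
    rcases le_total (max (c : ℝ) i.1) (min (d : ℝ) i.2) with hle | hle
    · exact h _ _ hle ((Icc_subset_Icc (le_max_right _ _) (min_le_right _ _)).trans hi)
    · simp [Ioo_eq_empty_of_le hle]
  rwa [Measure.restrict_eq_self_of_ae_mem (measure_eq_zero_iff_ae_notMem.1 hμ |>.mono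
      fun x hx => not_not.1 hx), Measure.restrict_eq_self_of_ae_mem
      (measure_eq_zero_iff_ae_notMem.1 hν |>.mono fun x hx => not_not.1 hx)] at hres

end Density

lemma LogAdmissible.mono {S R : Finset ℝ} {ν : Measure ℝ} (h : LogAdmissible R ν) (hSR : S ⊆ R) :
    LogAdmissible S ν :=
  ⟨h.prob, h.nonneg, h.noAtoms, h.mean, h.energy, fun r hr => h.log_sub r (hSR hr)⟩

lemma eq_zero_of_mem_frontier_support {μ : Measure ℝ} {f : ℝ → ℝ} (hf : ContinuousOn f (Ioi 0))
    (hf0 : ∀ x ∈ Ioi (0 : ℝ), 0 ≤ f x)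
    (hμ : μ = (volume.restrict (Ioi 0)).withDensity fun x => ENNReal.ofReal (f x)) {a : ℝ}
    (ha : a ∈ frontier μ.support) (ha0 : 0 < a) : f a = 0 := by
  set U := Ioi (0 : ℝ) ∩ μ.supportᶜ with hU
  have hUo : IsOpen U := isOpen_Ioi.inter Measure.isOpen_compl_support
  have hfU : ContinuousOn f U := hf.mono inter_subset_left
  have hUμ : μ U = 0 := measure_mono_null inter_subset_right Measure.measure_compl_support
  rw [hμ, withDensity_apply _ hUo.measurableSet, Measure.restrict_restrict hUo.measurableSet,
    inter_eq_left.2 (inter_subset_left : U ⊆ Ioi 0), lintegral_eq_zero_iff'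
    (hfU.aemeasurable hUo.measurableSet).ennreal_ofReal] at hUμ
  have hae : f =ᵐ[volume.restrict U] fun _ => 0 := by
    filter_upwards [hUμ, ae_restrict_mem hUo.measurableSet] with x hx hxU
    exact le_antisymm (ENNReal.ofReal_eq_zero.1 hx) (hf0 x hxU.1)
  have hzero := Measure.eqOn_open_of_ae_eq hae hUo hfU continuousOn_const
  have hacl : a ∈ closure U := by
    refine isOpen_Ioi.inter_closure ⟨ha0, ?_⟩
    rw [frontier_eq_closure_inter_closure] at ha
    exact ha.2
  have hc : ContinuousWithinAt f U a :=
    (hf a ha0).mono inter_subset_left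
  have := hc.mem_closure (t := {0}) hacl fun x hx => hzero hx
  simpa using this

theorem proposition4p1 (A : Finset ℝ[X]) (hA : ∀ Q ∈ A, Q.Splits)
    (μ : Measure ℝ) (hμ : IsPrimalSolution A μ) :
    ∃ f : ℝ → ℝ,
      ContinuousOn f (Ioi 0) ∧
      (∀ x ∈ Ioi (0 : ℝ), 0 ≤ f x) ∧
      μ = (volume.restrict (Ioi 0)).withDensity (fun x => ENNReal.ofReal (f x)) ∧
      ∀ a ∈ frontier μ.support, 0 < a → f a = 0 := by
  obtain ⟨a, l, S, m, ha, hl, hS, hm, hpos, hmin⟩ := hμ.exists_lagrangian_le hA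
  have hadm := hμ.logAdmissible.mono hS
  have := hadm.prob
  have := hadm.noAtoms
  have hmin' : ∀ ν, LogAdmissible S ν → lagrangian a l S m μ ≤ lagrangian a l S m ν :=
    fun ν hν => lagrangian_le_of_subset hmin hν
  have hl0 := hadm.energy_multiplier_pos ha hl hm hpos hmin'
  obtain ⟨c, hquad⟩ := hadm.exists_quadratic hl (fun r hr => (hm r hr).le) hmin'
  set f := discriminantDensity (C l * wallPoly S) (fieldPoly a S m) c with hf
  have hcont : ContinuousOn f (Ioi 0) := by
    refine continuousOn_discriminantDensity fun t ht h0 => ?_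
    rw [eval_mul, eval_C, mul_eq_zero, or_iff_right hl0.ne'] at h0
    have htS : t ∈ S := by
      by_contra hn
      exact eval_wallPoly_ne_zero ht hn h0
    exact eval_fieldPoly_ne_zero ht htS (hm t htS).ne'
  have hnonneg : ∀ x ∈ Ioi (0 : ℝ), 0 ≤ f x := fun x _ => discriminantDensity_nonneg _ _ _ x
  have hden : μ = (volume.restrict (Ioi 0)).withDensity fun x => ENNReal.ofReal (f x) := by
    have hOc : (regularSet S)ᶜ = (Iio 0 ∪ {0}) ∪ S := by
      ext x
      simp only [regularSet, mem_compl_iff, Set.mem_sdiff, mem_Ioi, mem_union, mem_Iio,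
        mem_singleton_iff, not_and, not_not, ← le_iff_lt_or_eq]
      rw [← not_lt]
      tauto
    have hO : IsOpen (regularSet S) := isOpen_Ioi.sdiff S.finite_toSet.isClosed
    refine measure_eq_of_Ioo_eq hO ?_ ?_ fun b d hbd hsub => ?_
    · rw [hOc]
      exact measure_union_null (measure_union_null hadm.nonneg (measure_singleton 0))
        (S.finite_toSet.measure_zero μ)
    · refine withDensity_absolutelyContinuous _ _ ?_
      rw [hOc]
      refine measure_union_null (measure_union_null ?_ (measure_singleton 0))
        (S.finite_toSet.measure_zero _)
      rw [Measure.restrict_apply measurableSet_Iio]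
      have : Iio (0 : ℝ) ∩ Ioi 0 = ∅ := by
        ext x
        simp only [mem_inter_iff, mem_Iio, mem_Ioi, mem_empty_iff_false, iff_false]
        exact fun h => lt_asymm h.1 h.2
      rw [this, measure_empty]
    · rw [measure_Ioo_eq_of_quadratic hl0 hquad hbd hsub hcont,
        withDensity_apply _ measurableSet_Ioo, Measure.restrict_restrict measurableSet_Ioo,
        inter_eq_left.2 (Ioo_subset_Icc_self.trans (hsub.trans sdiff_subset))]
  exact ⟨f, hcont, hnonneg, hden, fun x hx hx0 =>
    eq_zero_of_mem_frontier_support hcont hnonneg hden hx hx0⟩
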